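/- Let $p>2$. Let $h:[0,\infty)\to\mathbb{R}$ be a nonnegative $C^1$ function such that $h(t)>0$ for all $t\ge t_0$, for some $t_0>0$, and $$\lim_{t\to\infty}\frac{h'(t)}{t^{p-1}h(t)}=0 .$$ Put $f(t)=h(t)e^{t^p}$ for $t\ge 0$. For every $n\in\mathbb{N}$ let $\lambda_n>0$, $\mu_n\in\mathbb{R}$ and $u_n:[0,1]\to\mathbb{R}$ be such that $u_n$ is a classical solution of $$-u_n''-\frac1r u_n'=\lambda_n f(u_n),\quad u_n>0\ \text{ in }(0,1),\qquad u_n(0)=\mu_n,\quad u_n'(0)=0=u_n(1),$$ and suppose that $\mu_n\to\infty$ as $n\to\infty$. Define $(\delta_k)_{k\ge0}$ and $(a_k)_{k\ge0}$ by $\delta_0=1$, $a_0=2$ and, for $k\ge1$, by letting $\delta_k$ be the unique number in $(0,\delta_{k-1})$ with $$\frac{2p}{2+a_{k-1}}\left(1-\frac{\delta_k}{\delta_{k-1}}\right)-1+\left(\frac{\delta_k}{\delta_{k-1}}\right)^p=0,$$ and $$a_k=2-\left(\frac{\delta_k}{\delta_{k-1}}\right)^{p-1}(2+a_{k-1})\in(0,2).$$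 For $k\ge 0$, call a sequence $(r_{k,n})_n\subset(0,1)$ a sequence of centres of the $k$-th bubble if, as $n\to\infty$, $$\frac{u_n(r_{k,n})}{\mu_n}\to\delta_k\qquad\text{and}\qquad p\lambda_n r_{k,n}^2\,u_n(r_{k,n})^{p-1}f(u_n(r_{k,n}))\to\frac{a_k^2}{2}.$$ Then the following hold. 1. For every sequence $(r_n)\subset(0,1)$ with $u_n(r_n)/\mu_n\to0$, $$\lim_{n\to\infty}p\int_0^{r_n}\lambda_n u_n^{p-1}f(u_n)\,r\,dr=\infty\qquad\text{and}\qquad \lim_{n\to\infty}p\mu_n^{p-1}\int_0^{r_n}\lambda_n f(u_n)\,r\,dr=\infty .$$ 2. $\displaystyle\lim_{n\to\infty}\frac{\log(1/\lambda_n)}{\mu_n^p}=0$. 3. For every $k\ge0$, sequences of centres of the $k$-th bubble exist, and every such sequence $(r_{k,n})_n$ satisfies $$\lim_{n\to\infty}\frac{\log(1/r_{k,n})}{\mu_n^p}=\frac{\delta_k^p}{2}.$$ 4. For every $r\in[0,1)$, $\displaystyle\lim_{n\to\infty}p\mu_n^{p-1}u_n(r)=\infty$. -/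

import Mathlib

open Filter Topology Set

noncomputable section

/-- The nonlinearity `f(t) = h(t) e^{t^p}` (only its values at `t ≥ 0` matter). -/
def nonlin (p : ℝ) (h : ℝ → ℝ) (t : ℝ) : ℝ := h t * Real.exp (t ^ p)

/-- Standing assumption on `h : [0,∞) → ℝ`: it is nonnegative, of class `C¹`, and positive on some
half-line `[t₀,∞)` with `t₀ > 0`. Values of `h` at negative arguments are irrelevant. -/
structure StandingCond (h : ℝ → ℝ) : Prop where
  contDiffOn : ContDiffOn ℝ 1 h (Ici 0)
  nonneg : ∀ t, 0 ≤ t → 0 ≤ h t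
  eventually_pos : ∃ t₀ : ℝ, 0 < t₀ ∧ ∀ t, t₀ ≤ t → 0 < h t

/-- The growth condition `h'(t) / (t^{p-1} h(t)) → 0` as `t → ∞`. -/
def GrowthCond (p : ℝ) (h : ℝ → ℝ) : Prop :=
  Tendsto (fun t : ℝ => deriv h t / (t ^ (p - 1) * h t)) atTop (𝓝 0)

/-- `(lam, mu, u)` solves the radial problem
`-u'' - u'/r = lam f(u)`, `u > 0` in `(0,1)`, `u(0) = mu`, `u'(0) = 0 = u(1)`, with `lam > 0`,
in the classical sense: `u` is continuous on `[0,1]`, `C²` in `(0,1)` and has the (one-sided)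
derivative `0` at the origin. -/
structure IsRadialSolution (p : ℝ) (h : ℝ → ℝ) (lam mu : ℝ) (u : ℝ → ℝ) : Prop where
  lam_pos : 0 < lam
  continuousOn : ContinuousOn u (Icc 0 1)
  contDiffOn : ContDiffOn ℝ 2 u (Ioo 0 1)
  equation : ∀ r ∈ Ioo (0 : ℝ) 1,
    -(deriv (deriv u) r) - 1 / r * deriv u r = lam * nonlin p h (u r)
  pos : ∀ r ∈ Ioo (0 : ℝ) 1, 0 < u r
  apply_zero : u 0 = mu
  deriv_zero : HasDerivWithinAt u 0 (Icc 0 1) 0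
  apply_one : u 1 = 0

/-- The set of all `d ∈ (0, δ)` with `(2p / (2 + a)) (1 - d/δ) - 1 + (d/δ)^p = 0`.
For `p > 2`, `δ > 0` and `0 < a ≤ 2` it has exactly one element (see `nextDelta_unique`
and `nextDelta_exists`). -/
def nextDeltaSet (p δ a : ℝ) : Set ℝ :=
  {d | 0 < d ∧ d < δ ∧ 2 * p / (2 + a) * (1 - d / δ) - 1 + (d / δ) ^ p = 0}

/-- The pair `(δ_k, a_k)`: `δ_0 = 1`, `a_0 = 2`; `δ_{k+1}` is the unique `d ∈ (0, δ_k)` with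
`(2p / (2 + a_k)) (1 - d/δ_k) - 1 + (d/δ_k)^p = 0`, and
`a_{k+1} = 2 - (δ_{k+1}/δ_k)^{p-1} (2 + a_k)`. -/
def bubblePair (p : ℝ) : ℕ → ℝ × ℝ
  | 0 => (1, 2)
  | k + 1 =>
    (sInf (nextDeltaSet p (bubblePair p k).1 (bubblePair p k).2),
      2 - (sInf (nextDeltaSet p (bubblePair p k).1 (bubblePair p k).2) / (bubblePair p k).1)
        ^ (p - 1) * (2 + (bubblePair p k).2))

/-- The numbers `δ_k`. -/
def bubbleDelta (p : ℝ) (k : ℕ) : ℝ := (bubblePair p k).1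

/-- The numbers `a_k`. -/
def bubbleA (p : ℝ) (k : ℕ) : ℝ := (bubblePair p k).2

/-- The function `φ(r) = p lam r² u(r)^{p-1} f(u(r))`. -/
def bubblePhi (p : ℝ) (h : ℝ → ℝ) (lam : ℝ) (u : ℝ → ℝ) (r : ℝ) : ℝ :=
  p * lam * r ^ 2 * u r ^ (p - 1) * nonlin p h (u r)

/-- `r_n ∈ (0,1)` is a sequence of centres of the `k`-th bubble of the solutions
`(lam n, mu n, u n)`: `u_n(r_n)/mu_n → δ_k` and `φ_n(r_n) → a_k²/2`. -/
structure IsBubbleCentre (p : ℝ) (h : ℝ → ℝ) (lam mu : ℕ → ℝ) (u : ℕ → ℝ → ℝ) (k : ℕ)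
    (r : ℕ → ℝ) : Prop where
  mem : ∀ n, r n ∈ Ioo (0 : ℝ) 1
  height : Tendsto (fun n => u n (r n) / mu n) atTop (𝓝 (bubbleDelta p k))
  phi : Tendsto (fun n => bubblePhi p h (lam n) (u n) (r n)) atTop (𝓝 (bubbleA p k ^ 2 / 2))

end

/-! Well-posedness of the recursion defining `δ_k` and `a_k`. -/

theorem bubble_bernoulli {p x : ℝ} (hp : 1 < p) (h0 : 0 < x) (h1 : x < 1) :
    x ^ p + p * x ^ (p - 1) * (1 - x) < 1 := by
  have hs : -1 ≤ 1 / x - 1 := by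
    have : 0 < 1 / x := by positivity
    linarith
  have hs' : 1 / x - 1 ≠ 0 := by
    have : 1 < 1 / x := by rw [lt_div_iff₀ h0]; linarith
    linarith
  have key := one_add_mul_self_lt_rpow_one_add hs hs' hp
  have hxp : 0 < x ^ p := Real.rpow_pos_of_pos h0 p
  have e1 : (1 + (1 / x - 1)) ^ p * x ^ p = 1 := by
    rw [← Real.mul_rpow (by linarith) h0.le]
    have : (1 + (1 / x - 1)) * x = 1 := by field_simp; ring
    rw [this, Real.one_rpow]
  have e2 : x ^ (p - 1) = x ^ p / x := by rw [Real.rpow_sub_one h0.ne']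
  have e3 : (1 + p * (1 / x - 1)) * x ^ p = x ^ p + p * x ^ (p - 1) * (1 - x) := by
    rw [e2]; field_simp
  have := mul_lt_mul_of_pos_right key hxp
  rw [e1, e3] at this
  exact this

theorem bubble_root_rpow_lt {p c x : ℝ} (hp : 1 < p) (h0 : 0 < x) (h1 : x < 1)
    (hx : c * (1 - x) - 1 + x ^ p = 0) : p * x ^ (p - 1) < c := by
  have := bubble_bernoulli hp h0 h1
  have h2 : (p * x ^ (p - 1)) * (1 - x) < c * (1 - x) := by linarith
  exact lt_of_mul_lt_mul_right h2 (by linarith)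

theorem bubble_root_unique {p c x y : ℝ} (hp : 1 < p) (hx0 : 0 < x) (hxy : x < y) (hy1 : y < 1)
    (hx : c * (1 - x) - 1 + x ^ p = 0) (hy : c * (1 - y) - 1 + y ^ p = 0) : False := by
  have hconv := (strictConvexOn_rpow hp).2 (show x ∈ Ici (0 : ℝ) from hx0.le)
    (show (1 : ℝ) ∈ Ici (0 : ℝ) from Set.mem_Ici.2 zero_le_one) (by linarith : x ≠ 1)
    (show 0 < (1 - y) / (1 - x) from div_pos (by linarith) (by linarith))
    (show 0 < (y - x) / (1 - x) from div_pos (by linarith) (by linarith))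
    (by rw [← add_div, div_eq_one_iff_eq (by linarith)]; ring)
  have hne : (1 - x) ≠ 0 := by linarith
  simp only [smul_eq_mul, Real.one_rpow, mul_one] at hconv
  have e : (1 - y) / (1 - x) * x + (y - x) / (1 - x) = y := by field_simp; ring
  rw [e] at hconv
  have ex : x ^ p = 1 - c * (1 - x) := by linarith
  have e2 : (1 - y) / (1 - x) * (1 - c * (1 - x)) + (y - x) / (1 - x) = 1 - c * (1 - y) := by
    field_simp; ring
  rw [ex, e2] at hconv
  linarith

theorem bubble_root_exists {p c : ℝ} (hp : 1 < p) (hc1 : 1 < c) (hcp : c < p) :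
    ∃ x : ℝ, 0 < x ∧ x < 1 ∧ c * (1 - x) - 1 + x ^ p = 0 := by
  have hp0 : 0 < p := by linarith
  have hq : 0 < c / p := by positivity
  have hq1 : c / p < 1 := by rw [div_lt_one hp0]; exact hcp
  set y : ℝ := (c / p) ^ (1 / (p - 1)) with hy
  have hy0 : 0 < y := Real.rpow_pos_of_pos hq _
  have hy1 : y < 1 := Real.rpow_lt_one hq.le hq1 (by apply one_div_pos.2; linarith)
  have hyp : y ^ (p - 1) = c / p := by
    rw [hy, ← Real.rpow_mul hq.le, one_div_mul_cancel (by linarith), Real.rpow_one]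
  have hb := bubble_bernoulli hp hy0 hy1
  rw [hyp, mul_div_cancel₀ _ hp0.ne'] at hb
  have hcont : ContinuousOn (fun x : ℝ => c * (1 - x) - 1 + x ^ p) (Icc 0 y) := by
    have : Continuous (fun x : ℝ => x ^ p) := Real.continuous_rpow_const hp0.le
    fun_prop
  have hmem : (0 : ℝ) ∈ Ioo (c * (1 - y) - 1 + y ^ p) (c * (1 - 0) - 1 + (0 : ℝ) ^ p) := by
    rw [Real.zero_rpow hp0.ne']
    constructor <;> linarith
  obtain ⟨x, hx, hx'⟩ := intermediate_value_Ioo' hy0.le hcont hmem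
  exact ⟨x, hx.1, hx.2.trans hy1, hx'⟩

theorem nextDelta_exists {p δ a : ℝ} (hp : 2 < p) (hδ : 0 < δ) (ha0 : 0 < a) (ha2 : a ≤ 2) :
    ∃ d, d ∈ nextDeltaSet p δ a := by
  have hc1 : 1 < 2 * p / (2 + a) := by rw [lt_div_iff₀ (by linarith)]; linarith
  have hcp : 2 * p / (2 + a) < p := by rw [div_lt_iff₀ (by linarith)]; nlinarith
  obtain ⟨x, h0, h1, hx⟩ := bubble_root_exists (by linarith) hc1 hcp
  refine ⟨x * δ, by positivity, by nlinarith, ?_⟩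
  rw [mul_div_cancel_right₀ _ hδ.ne']
  exact hx

theorem nextDelta_unique {p δ a d e : ℝ} (hp : 2 < p) (hδ : 0 < δ)
    (hd : d ∈ nextDeltaSet p δ a) (he : e ∈ nextDeltaSet p δ a) : d = e := by
  obtain ⟨hd0, hd1, hd2⟩ := hd
  obtain ⟨he0, he1, he2⟩ := he
  rcases lt_trichotomy d e with hlt | heq | hlt
  · exact (bubble_root_unique (by linarith) (div_pos hd0 hδ) (by gcongr)
      ((div_lt_one hδ).2 he1) hd2 he2).elim
  · exact heq
  · exact (bubble_root_unique (by linarith) (div_pos he0 hδ) (by gcongr)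
      ((div_lt_one hδ).2 hd1) he2 hd2).elim

theorem sInf_nextDeltaSet_mem {p δ a : ℝ} (hp : 2 < p) (hδ : 0 < δ) (ha0 : 0 < a) (ha2 : a ≤ 2) :
    sInf (nextDeltaSet p δ a) ∈ nextDeltaSet p δ a := by
  obtain ⟨d, hd⟩ := nextDelta_exists hp hδ ha0 ha2
  have : nextDeltaSet p δ a = {d} :=
    Set.eq_singleton_iff_unique_mem.2 ⟨hd, fun e he => nextDelta_unique hp hδ he hd⟩
  rw [this, csInf_singleton]
  exact Set.mem_singleton d

theorem bubblePair_bounds {p : ℝ} (hp : 2 < p) (k : ℕ) :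
    0 < bubbleDelta p k ∧ 0 < bubbleA p k ∧ bubbleA p k ≤ 2 := by
  induction k with
  | zero => simp [bubbleDelta, bubbleA, bubblePair]
  | succ k ih =>
    obtain ⟨hδ, ha0, ha2⟩ := ih
    obtain ⟨h0, h1, hx⟩ := sInf_nextDeltaSet_mem hp hδ ha0 ha2
    have hq0 := div_pos h0 hδ
    have hlt := bubble_root_rpow_lt (by linarith) hq0 ((div_lt_one hδ).2 h1) hx
    have hpos := Real.rpow_pos_of_pos hq0 (p - 1)
    rw [lt_div_iff₀ (by linarith)] at hlt
    have hprod := mul_pos hpos (show 0 < 2 + bubbleA p k by linarith)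
    refine ⟨h0, ?_, ?_⟩
    · change 0 < 2 - _ * (2 + bubbleA p k)
      change 0 < 2 - (sInf (nextDeltaSet p (bubbleDelta p k) (bubbleA p k)) / bubbleDelta p k)
        ^ (p - 1) * (2 + bubbleA p k)
      nlinarith
    · change 2 - (sInf (nextDeltaSet p (bubbleDelta p k) (bubbleA p k)) / bubbleDelta p k)
        ^ (p - 1) * (2 + bubbleA p k) ≤ 2
      linarith

/-- For `p > 2` the numbers `δ_k`, `a_k` satisfy the two recurrence relations, with
`δ_{k+1} ∈ (0, δ_k)` and `a_{k+1} ∈ (0, 2)`; by `nextDelta_unique` they are the only ones. -/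
theorem bubble_recurrence {p : ℝ} (hp : 2 < p) (k : ℕ) :
    bubbleDelta p 0 = 1 ∧ bubbleA p 0 = 2 ∧
    (0 < bubbleDelta p (k + 1) ∧ bubbleDelta p (k + 1) < bubbleDelta p k) ∧
    (0 < bubbleA p (k + 1) ∧ bubbleA p (k + 1) < 2) ∧
    2 * p / (2 + bubbleA p k) * (1 - bubbleDelta p (k + 1) / bubbleDelta p k) - 1
      + (bubbleDelta p (k + 1) / bubbleDelta p k) ^ p = 0 ∧
    bubbleA p (k + 1)
      = 2 - (bubbleDelta p (k + 1) / bubbleDelta p k) ^ (p - 1) * (2 + bubbleA p k) := by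
  obtain ⟨hδ, ha0, ha2⟩ := bubblePair_bounds hp k
  obtain ⟨hδ', ha0', -⟩ := bubblePair_bounds hp (k + 1)
  obtain ⟨h0, h1, hx⟩ := sInf_nextDeltaSet_mem hp hδ ha0 ha2
  have hA : bubbleA p (k + 1)
      = 2 - (bubbleDelta p (k + 1) / bubbleDelta p k) ^ (p - 1) * (2 + bubbleA p k) := rfl
  refine ⟨rfl, rfl, ⟨h0, h1⟩, ⟨ha0', ?_⟩, hx, hA⟩
  rw [hA]
  have hprod := mul_pos (Real.rpow_pos_of_pos (div_pos hδ' hδ) (p - 1))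
    (show 0 < 2 + bubbleA p k by linarith)
  linarith

/-!
In the variable `x = log r < 0`, put `V = u / μ`, `N = μ ^ p`, `Z = -p μ ^ (p - 1) r u'` and
`φ = p λ r ^ 2 u ^ (p - 1) f(u)`. The radial equation becomes the system `FastSlow`:
`V' = -Z / (p N)`, `Z' = φ / V ^ (p - 1)`, `φ' = φ (2 - V ^ (p - 1) Z (1 + o(1)))`, with
`(V, Z, φ) → (1, 0, 0)` at `-∞` and `V(0) = 0`. Here `V` varies on the scale `N → ∞`, and the
growth condition on `h` makes the error small as long as `V` stays away from zero.

*Bubbles.* While `V ≈ δ`, put `D = δ ^ (p - 1)`. The energy `φ + (2 - D Z) ^ 2 / 2` is almost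
conserved (`FastSlow.abs_energy_sub_le`). A solution that enters with `D Z ≈ 2 - a` and `φ ≈ 0`
therefore passes a centre, where `D Z = 2` and `φ ≈ a ^ 2 / 2`, and leaves with `D Z ≈ 2 + a` and
`φ ≈ 0`. This takes a time of order `log N` only, so `V` does not move
(`FastSlow.bubble_passage`).

*Flights.* Between two bubbles `φ` is negligible, so `Z` is constant, `V` is affine in `x`, and
`log φ / N` is the convex function `flightPotential` of `V`, whose zero in `(0, δ)` is the height of
the next bubble (`HasQuietPoints.flight`). This is the recursion for `δ_k` and `a_k`, and the flight
cannot be interrupted: `V` would have to vanish at `x = 0`, but it would first pass the height at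
which `φ` has become large again. The induction gives centres of all bubbles
(`hasCentres_bubble`).

*Consequences.* The heights tend to zero (`tendsto_bubbleDelta`), because `a_k ≥ 2 δ_k ^ (p - 1)`,
so a positive limit of `δ_k` would keep the ratios `δ_{k+1} / δ_k` away from one. At the `k`-th
centre, concavity of `u` in `log (1 / r)` gives `log (1 / r) ≤ (p δ_k ^ p / 2 + o(1)) μ ^ p`;
together with the limit of `log φ` this bounds `|log λ| / μ ^ p` by a multiple of `δ_k ^ p` for
every `k`, hence `log λ = o(μ ^ p)`, and then the limit of `log φ` gives the position of the
centres. Finally, `p ∫ λ u ^ (p - 1) f(u) r dr` between two centres of heights `δ > δ'` is at least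
`2 - 2 (δ' / δ) ^ (p - 1) - o(1)`, which exceeds `1` if `δ' / δ` is small, so the integral diverges.
The last assertion follows from `Z ≥ (2 - o(1)) / δ_k ^ (p - 1)` beyond the `k`-th centre and
concavity.
-/

/-! ### The heights `δ_k` tend to zero -/

/-- The mean of `y ^ (2 p - 2)` over `[x, 1]` is at least its value at the geometric mean of the
end points. -/
theorem one_sub_rpow_ge {p x : ℝ} (hp : 1 < p) (h0 : 0 < x) (h1 : x ≤ 1) :
    (2 * p - 1) * x ^ (p - 1) * (1 - x) ≤ 1 - x ^ (2 * p - 1) := by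
  have hd : ∀ y : ℝ, 0 < y → HasDerivAt
      (fun y : ℝ => 1 - y ^ (2 * p - 1) - (2 * p - 1) * y ^ (p - 1) * (1 - y))
      (-((2 * p - 1) * y ^ (p - 2) * (y ^ p + (p - 1) - p * y))) y := by
    intro y hy
    have e1 := (Real.hasDerivAt_rpow_const (x := y) (p := 2 * p - 1) (Or.inl hy.ne'))
    have e2 := (Real.hasDerivAt_rpow_const (x := y) (p := p - 1) (Or.inl hy.ne'))
    have := (e1.const_sub 1).sub ((e2.const_mul (2 * p - 1)).mul ((hasDerivAt_id y).const_sub 1))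
    refine this.congr_deriv ?_
    have a1 : y ^ (2 * p - 1 - 1) = y ^ (p - 2) * y ^ p := by
      rw [← Real.rpow_add hy]; ring_nf
    have a2 : y ^ (p - 1 - 1) = y ^ (p - 2) := by ring_nf
    have a3 : y ^ (p - 1) = y ^ (p - 2) * y := by
      rw [← Real.rpow_add_one hy.ne']; ring_nf
    simp only [id, a1, a2, a3]
    ring
  have hanti : AntitoneOn
      (fun y : ℝ => 1 - y ^ (2 * p - 1) - (2 * p - 1) * y ^ (p - 1) * (1 - y)) (Icc x 1) := by
    apply antitoneOn_of_deriv_nonpos (convex_Icc x 1)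
    · intro y hy
      exact (hd y (h0.trans_le hy.1)).continuousAt.continuousWithinAt
    · intro y hy
      rw [interior_Icc] at hy
      exact (hd y (h0.trans hy.1)).differentiableAt.differentiableWithinAt
    · intro y hy
      rw [interior_Icc] at hy
      have hy0 := h0.trans hy.1
      rw [(hd y hy0).deriv]
      have hb := one_add_mul_self_le_rpow_one_add (show -1 ≤ y - 1 by linarith) hp.le
      rw [show 1 + (y - 1) = y by ring] at hb
      have := mul_nonneg (mul_nonneg (show 0 ≤ 2 * p - 1 by linarith)
        (Real.rpow_pos_of_pos hy0 (p - 2)).le)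
        (show 0 ≤ y ^ p + (p - 1) - p * y by linarith)
      linarith
  have := hanti (left_mem_Icc.2 h1) (right_mem_Icc.2 h1) h1
  simp only [Real.one_rpow, sub_self, mul_zero] at this
  linarith

/-- In terms of the ratio `x` of consecutive heights, this is exactly `one_sub_rpow_ge`. -/
theorem bubbleA_succ_ge {p : ℝ} (hp : 2 < p) (k : ℕ) :
    (bubbleDelta p (k + 1) / bubbleDelta p k) ^ (p - 1) * bubbleA p k ≤ bubbleA p (k + 1) := by
  obtain ⟨-, -, ⟨hd0, hd1⟩, -, hx, ha'⟩ := bubble_recurrence hp k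
  obtain ⟨hδ, ha0, ha2⟩ := bubblePair_bounds hp k
  have hx0 := div_pos hd0 hδ
  have hx1 := (div_lt_one hδ).2 hd1
  rw [ha']
  set x := bubbleDelta p (k + 1) / bubbleDelta p k
  set a := bubbleA p k
  have hD := one_sub_rpow_ge (p := p) (by linarith) hx0 hx1.le
  have e1 : x ^ (2 * p - 1) = x ^ (p - 1) * x ^ p := by
    rw [← Real.rpow_add hx0]; ring_nf
  have e2 : x ^ p = x ^ (p - 1) * x := by
    rw [← Real.rpow_add_one hx0.ne']; ring_nf
  have e3 : 2 * p * (1 - x) = (1 - x ^ p) * (2 + a) := by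
    field_simp at hx; linarith
  have hlt : x ^ p < 1 := Real.rpow_lt_one hx0.le hx1 (by linarith)
  rw [e1] at hD
  have key : 0 ≤ (1 - x ^ p) * (2 - x ^ (p - 1) * (2 + a) - x ^ (p - 1) * a) := by
    have : (1 - x ^ p) * (2 - x ^ (p - 1) * (2 + a) - x ^ (p - 1) * a)
      = 2 * ((1 - x ^ p) - x ^ (p - 1) * ((1 - x ^ p) * (2 + a) - (1 - x ^ p))) := by ring
    rw [this, ← e3]
    have h4 : x ^ (p - 1) - x ^ p = x ^ (p - 1) * (1 - x) := by rw [e2]; ring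
    nlinarith
  have := nonneg_of_mul_nonneg_right key (by linarith)
  linarith

theorem two_mul_rpow_le_bubbleA {p : ℝ} (hp : 2 < p) (k : ℕ) :
    2 * bubbleDelta p k ^ (p - 1) ≤ bubbleA p k := by
  induction k with
  | zero => simp [bubbleDelta, bubbleA, bubblePair]
  | succ k ih =>
    obtain ⟨hδ, ha0, ha2⟩ := bubblePair_bounds hp k
    obtain ⟨hδ', -, -⟩ := bubblePair_bounds hp (k + 1)
    refine le_trans ?_ (bubbleA_succ_ge hp k)
    have hq := Real.rpow_pos_of_pos (div_pos hδ' hδ) (p - 1)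
    have e : bubbleDelta p (k + 1) ^ (p - 1)
        = (bubbleDelta p (k + 1) / bubbleDelta p k) ^ (p - 1) * bubbleDelta p k ^ (p - 1) := by
      rw [← Real.mul_rpow (div_pos hδ' hδ).le hδ.le, div_mul_cancel₀ _ hδ.ne']
    rw [e]
    nlinarith

theorem bubbleDelta_strictAnti {p : ℝ} (hp : 2 < p) : StrictAnti (bubbleDelta p) :=
  strictAnti_nat_of_succ_lt fun k => (bubble_recurrence hp k).2.2.1.2

theorem bubbleDelta_le_one {p : ℝ} (hp : 2 < p) (k : ℕ) : bubbleDelta p k ≤ 1 :=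
  ((bubbleDelta_strictAnti hp).antitone (Nat.zero_le k)).trans_eq (bubble_recurrence hp 0).1

/-- If the heights had a positive limit, their ratios would tend to one, whereas
`(δ_{k+1} / δ_k) ^ (p - 1) < 2 / (2 + a_k)` and `a_k ≥ 2 δ_k ^ (p - 1)` stays away from zero. -/
theorem tendsto_bubbleDelta {p : ℝ} (hp : 2 < p) :
    Tendsto (bubbleDelta p) atTop (𝓝 0) := by
  have hbdd : BddBelow (range (bubbleDelta p)) :=
    ⟨0, by rintro _ ⟨k, rfl⟩; exact (bubblePair_bounds hp k).1.le⟩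
  have hlim := tendsto_atTop_ciInf (bubbleDelta_strictAnti hp).antitone hbdd
  set d := ⨅ k, bubbleDelta p k
  have hd : ∀ k, d ≤ bubbleDelta p k := fun k => ciInf_le hbdd k
  have hd0 : 0 ≤ d := le_ciInf fun k => (bubblePair_bounds hp k).1.le
  rcases hd0.eq_or_lt with h | h
  · rwa [← h] at hlim
  exfalso
  have hr : Tendsto (fun k => (bubbleDelta p (k + 1) / bubbleDelta p k) ^ (p - 1)) atTop
      (𝓝 ((d / d) ^ (p - 1))) :=
    ((hlim.comp (tendsto_add_atTop_nat 1)).div hlim h.ne').rpow_const (Or.inr (by linarith))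
  rw [div_self h.ne', Real.one_rpow] at hr
  have hα := Real.rpow_pos_of_pos h (p - 1)
  have hle : ∀ k, (bubbleDelta p (k + 1) / bubbleDelta p k) ^ (p - 1)
      ≤ 2 / (2 + 2 * d ^ (p - 1)) := by
    intro k
    obtain ⟨-, -, ⟨hd0, hd1⟩, ⟨ha0, -⟩, -, ha'⟩ := bubble_recurrence hp k
    obtain ⟨hδ, -, -⟩ := bubblePair_bounds hp k
    have h1 := Real.rpow_le_rpow h.le (hd k) (show 0 ≤ p - 1 by linarith)
    have h2 := two_mul_rpow_le_bubbleA hp k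
    have h3 := Real.rpow_pos_of_pos (div_pos hd0 hδ) (p - 1)
    rw [le_div_iff₀ (by linarith)]
    nlinarith
  have := le_of_tendsto' hr hle
  rw [le_div_iff₀ (by linarith)] at this
  linarith

/-! ### The slow-fast system in the variable `log r` -/

theorem le_of_hasDerivAt_nonneg {f : ℝ → ℝ} {a b : ℝ} (hab : a ≤ b)
    (h : ∀ x ∈ Icc a b, ∃ d, 0 ≤ d ∧ HasDerivAt f d x) : f a ≤ f b := by
  have : MonotoneOn f (Icc a b) := by
    apply monotoneOn_of_deriv_nonneg (convex_Icc a b)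
    · intro x hx
      obtain ⟨d, -, hd⟩ := h x hx
      exact hd.continuousAt.continuousWithinAt
    · intro x hx
      obtain ⟨d, -, hd⟩ := h x (interior_subset hx)
      exact hd.differentiableAt.differentiableWithinAt
    · intro x hx
      obtain ⟨d, h0, hd⟩ := h x (interior_subset hx)
      rw [hd.deriv]; exact h0
  exact this (left_mem_Icc.2 hab) (right_mem_Icc.2 hab) hab

theorem le_of_hasDerivAt_nonpos {f : ℝ → ℝ} {a b : ℝ} (hab : a ≤ b)
    (h : ∀ x ∈ Icc a b, ∃ d, d ≤ 0 ∧ HasDerivAt f d x) : f b ≤ f a := by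
  have := le_of_hasDerivAt_nonneg (f := fun x => -f x) hab (fun x hx => by
    obtain ⟨d, h0, hd⟩ := h x hx
    exact ⟨-d, by linarith, hd.neg⟩)
  linarith

/-- The radial problem in the variable `x = log r`, for `V = u / μ`, `Z = -p μ ^ (p - 1) r u'` and
`φ = bubblePhi`, with `N = μ ^ p`. The equations for `V` and `Z` are exact. The one for `φ`, where
the factor `h` enters, holds up to a relative error `η` of size at most `ρ`, as long as `V ≥ ρ`.
For large `N` the variable `V` is slow, while `(Z, φ)` follows a conservative planar system. -/
structure FastSlow (p N ρ : ℝ) (V Z φ : ℝ → ℝ) : Prop where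
  one_lt : 1 < p
  N_pos : 0 < N
  continuousOn_V : ContinuousOn V (Iic 0)
  V_zero : V 0 = 0
  V_pos : ∀ x < 0, 0 < V x
  V_le_one : ∀ x < 0, V x ≤ 1
  Z_nonneg : ∀ x < 0, 0 ≤ Z x
  phi_nonneg : ∀ x < 0, 0 ≤ φ x
  phi_pos : ∀ x < 0, ρ ≤ V x → 0 < φ x
  hasDerivAt_V : ∀ x < 0, HasDerivAt V (-Z x / (p * N)) x
  hasDerivAt_Z : ∀ x < 0, HasDerivAt Z (φ x / V x ^ (p - 1)) x
  hasDerivAt_phi : ∀ x < 0, ρ ≤ V x → ∃ η, |η| ≤ ρ ∧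
    HasDerivAt φ (φ x * (2 - V x ^ (p - 1) * Z x * (1 + η))) x
  tendsto_V : Tendsto V atBot (𝓝 1)
  tendsto_Z : Tendsto Z atBot (𝓝 0)
  tendsto_phi : Tendsto φ atBot (𝓝 0)

namespace FastSlow

variable {p N ρ : ℝ} {V Z φ : ℝ → ℝ}

theorem pN_pos (S : FastSlow p N ρ V Z φ) : 0 < p * N :=
  mul_pos (by linarith [S.one_lt]) S.N_pos

theorem antitoneOn_V (S : FastSlow p N ρ V Z φ) : AntitoneOn V (Iic 0) := by
  apply antitoneOn_of_deriv_nonpos (convex_Iic 0) S.continuousOn_V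
  · intro x hx
    rw [interior_Iic] at hx
    exact (S.hasDerivAt_V x hx).differentiableAt.differentiableWithinAt
  · intro x hx
    rw [interior_Iic] at hx
    rw [(S.hasDerivAt_V x hx).deriv]
    exact div_nonpos_of_nonpos_of_nonneg (by linarith [S.Z_nonneg x hx]) S.pN_pos.le

theorem Z_le (S : FastSlow p N ρ V Z φ) {x y : ℝ} (hxy : x ≤ y) (hy : y < 0) : Z x ≤ Z y :=
  le_of_hasDerivAt_nonneg hxy fun t ht => ⟨_, div_nonneg (S.phi_nonneg t (ht.2.trans_lt hy))
    (Real.rpow_pos_of_pos (S.V_pos t (ht.2.trans_lt hy)) _).le,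
    S.hasDerivAt_Z t (ht.2.trans_lt hy)⟩

/-- `V` is concave: its decrease on `[x, y]` is at least that along the tangent at `x`. -/
theorem mul_Z_le (S : FastSlow p N ρ V Z φ) {x y : ℝ} (hxy : x ≤ y) (hy : y ≤ 0) :
    Z x * (y - x) ≤ p * N * (V x - V y) := by
  have hc : ∀ t ∈ interior (Icc x y), deriv V t ≤ -Z x / (p * N) := by
    intro t ht
    rw [interior_Icc] at ht
    have ht0 := ht.2.trans_le hy
    rw [(S.hasDerivAt_V t ht0).deriv]
    have := S.Z_le ht.1.le ht0
    have := S.pN_pos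
    gcongr
  have := (convex_Icc x y).image_sub_le_mul_sub_of_deriv_le
    (S.continuousOn_V.mono fun t ht => ht.2.trans hy)
    (fun t ht => by
      rw [interior_Icc] at ht
      exact (S.hasDerivAt_V t (ht.2.trans_le hy)).differentiableAt.differentiableWithinAt)
    hc x (left_mem_Icc.2 hxy) y (right_mem_Icc.2 hxy) hxy
  have hpN := S.pN_pos
  rw [div_mul_eq_mul_div, le_div_iff₀ hpN] at this
  linarith

theorem le_mul_Z (S : FastSlow p N ρ V Z φ) {x y z : ℝ} (hxy : x ≤ y) (hy : y < 0)
    (hz : Z y ≤ z) : p * N * (V x - V y) ≤ z * (y - x) := by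
  have hpN := S.pN_pos
  have := le_of_hasDerivAt_nonneg (f := fun t => V t + t * (z / (p * N))) hxy fun t ht =>
    ⟨-Z t / (p * N) + z / (p * N), by
      rw [← add_div]
      exact div_nonneg (by linarith [S.Z_le ht.2 hy]) hpN.le,
      by
        simpa using (S.hasDerivAt_V t (ht.2.trans_lt hy)).fun_add
          ((hasDerivAt_id t).mul_const (z / (p * N)))⟩
  have hpN0 := hpN.ne'
  have e : p * N * (V y + y * (z / (p * N))) = p * N * V y + y * z := by
    rw [mul_add, mul_left_comm, mul_div_cancel₀ _ hpN0]
  have e' : p * N * (V x + x * (z / (p * N))) = p * N * V x + x * z := by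
    rw [mul_add, mul_left_comm, mul_div_cancel₀ _ hpN0]
  have := mul_le_mul_of_nonneg_left this hpN.le
  rw [e, e'] at this
  linarith

/-- Each value of `V` below its value at `x` is attained to the right of `x`. -/
theorem exists_V_eq (S : FastSlow p N ρ V Z φ) {x v : ℝ} (hx : x < 0) (hv : 0 < v)
    (hvx : v < V x) : ∃ y, x < y ∧ y < 0 ∧ V y = v := by
  have := intermediate_value_Ioo' hx.le (S.continuousOn_V.mono fun t ht => ht.2)
  obtain ⟨y, hy, rfl⟩ := this ⟨by rw [S.V_zero]; exact hv, hvx⟩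
  exact ⟨y, hy.1, hy.2, rfl⟩

theorem continuousAt_phi (S : FastSlow p N ρ V Z φ) {x : ℝ} (hx : x < 0) (h : ρ ≤ V x) :
    ContinuousAt φ x := by
  obtain ⟨η, -, hd⟩ := S.hasDerivAt_phi x hx h
  exact hd.continuousAt

/-- Before the first bubble: `φ` reaches a small level `θ` while `Z` and `1 - V` are still bounded
by multiples of `θ`, because `φ` grows at least exponentially there. -/
theorem exists_entry_first (S : FastSlow p N ρ V Z φ) {ε θ : ℝ} (hε1 : ε < 1)
    (hεp : 1 / 2 ≤ (1 - ε) ^ (p - 1)) (hρ : ρ ≤ 1 / 2) (hρε : ρ ≤ 1 - ε) (hθ0 : 0 < θ)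
    (hθε : θ < ε) (hθ : θ < 1 / 8) (hN : 2 ≤ p * N) :
    ∃ σ < 0, φ σ = θ ∧ Z σ ≤ 2 * θ ∧ 1 - V σ ≤ θ := by
  -- `σ` is the first point at which one of the three smallness conditions fails
  set A : Set ℝ := {x | x < 0 ∧ (θ ≤ φ x ∨ V x ≤ 1 - ε ∨ 1 / 4 ≤ Z x)} with hA
  have hVbot : ∀ᶠ x in atBot, 1 - ε < V x := S.tendsto_V.eventually_const_lt (by linarith)
  have hne : A.Nonempty := by
    obtain ⟨x0, hx0, hx1⟩ := (hVbot.and (eventually_lt_atBot (0 : ℝ))).exists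
    obtain ⟨y, -, hy0, hy⟩ := S.exists_V_eq hx1 (by linarith : 0 < 1 - ε) hx0
    exact ⟨y, hy0, Or.inr (Or.inl hy.le)⟩
  have hbdd : BddBelow A := by
    have hphi := S.tendsto_phi.eventually_lt_const hθ0
    have hZ := S.tendsto_Z.eventually_lt_const (show (0 : ℝ) < 1 / 4 by norm_num)
    obtain ⟨b, hb⟩ := eventually_atBot.1 (hVbot.and (hphi.and hZ))
    refine ⟨b, fun x hx => ?_⟩
    by_contra hlt
    obtain ⟨h1, h2, h3⟩ := hb x (not_le.1 hlt).le
    rcases hx.2 with h | h | h <;> linarith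
  set σ := sInf A
  have hσ0 : σ < 0 := by
    obtain ⟨y, hy⟩ := hne
    exact (csInf_le hbdd hy).trans_lt hy.1
  have hleft : ∀ x < σ, φ x < θ ∧ 1 - ε < V x ∧ Z x < 1 / 4 := by
    intro x hx
    have hxA : x ∉ A := fun h => absurd (csInf_le hbdd h) (not_le.2 hx)
    simp only [hA, mem_ofPred_eq, not_and, not_or, not_le] at hxA
    exact hxA (hx.trans hσ0)
  have hcV := (S.hasDerivAt_V σ hσ0).continuousAt
  have hcZ := (S.hasDerivAt_Z σ hσ0).continuousAt
  have hself : ∀ᶠ x in 𝓝[<] σ, x < σ := eventually_mem_nhdsWithin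
  have hVσ : 1 - ε ≤ V σ := ge_of_tendsto (hcV.tendsto.mono_left nhdsWithin_le_nhds)
    (hself.mono fun x hx => (hleft x hx).2.1.le)
  have hcφ := S.continuousAt_phi hσ0 (hρε.trans hVσ)
  have hZσ : Z σ ≤ 1 / 4 := le_of_tendsto (hcZ.tendsto.mono_left nhdsWithin_le_nhds)
    (hself.mono fun x hx => (hleft x hx).2.2.le)
  have hφσ : φ σ ≤ θ := le_of_tendsto (hcφ.tendsto.mono_left nhdsWithin_le_nhds)
    (hself.mono fun x hx => (hleft x hx).1.le)
  have hV : ∀ x ≤ σ, 1 - ε ≤ V x := fun x hx =>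
    hx.lt_or_eq.elim (fun h => (hleft x h).2.1.le) (fun h => h ▸ hVσ)
  -- the growth of `φ` dominates the growth of `Z` and the decay of `V`
  have hgrow : ∀ x ≤ σ, ∃ d, φ x ≤ d ∧ HasDerivAt φ d x := by
    intro x hx
    have hx0 := hx.trans_lt hσ0
    obtain ⟨η, hη, hd⟩ := S.hasDerivAt_phi x hx0 (hρε.trans (hV x hx))
    refine ⟨_, ?_, hd⟩
    have hz := (S.Z_le hx hσ0).trans hZσ
    have hz0 := S.Z_nonneg x hx0
    have hv1 : V x ^ (p - 1) ≤ 1 :=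
      Real.rpow_le_one (S.V_pos x hx0).le (S.V_le_one x hx0) (by linarith [S.one_lt])
    have hv0 := (Real.rpow_pos_of_pos (S.V_pos x hx0) (p - 1)).le
    have hη' := abs_le.1 (hη.trans hρ)
    have h1 : V x ^ (p - 1) * Z x ≤ 1 / 4 := by nlinarith
    have h2 : V x ^ (p - 1) * Z x * (1 + η) ≤ 1 := by
      nlinarith [mul_nonneg hv0 hz0]
    nlinarith [S.phi_nonneg x hx0]
  have hφ0 : ∀ x ≤ σ, 0 ≤ φ x := fun x hx => S.phi_nonneg x (hx.trans_lt hσ0)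
  have hZ2 : ∀ y ≤ σ, Z y ≤ 2 * φ y := by
    intro y hy
    have hmono : ∀ x ≤ y, 2 * φ x - Z x ≤ 2 * φ y - Z y := fun x hx =>
      le_of_hasDerivAt_nonneg (f := fun t => 2 * φ t - Z t) hx fun t ht => by
        have hts := ht.2.trans hy
        obtain ⟨d, hd0, hd⟩ := hgrow t hts
        refine ⟨_, ?_, (hd.const_mul 2).sub (S.hasDerivAt_Z t (hts.trans_lt hσ0))⟩
        have hvp : 1 / 2 ≤ V t ^ (p - 1) := hεp.trans
          (Real.rpow_le_rpow (by linarith) (hV t hts) (by linarith [S.one_lt]))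
        have : φ t / V t ^ (p - 1) ≤ 2 * φ t := by
          rw [div_le_iff₀ (by linarith)]
          nlinarith [hφ0 t hts]
        linarith
    have hlim : Tendsto (fun x => 2 * φ x - Z x) atBot (𝓝 (2 * 0 - 0)) :=
      (S.tendsto_phi.const_mul 2).sub S.tendsto_Z
    have := le_of_tendsto hlim ((eventually_le_atBot y).mono hmono)
    linarith
  have hV1 : 1 - V σ ≤ φ σ := by
    have hmono : ∀ x ≤ σ, φ x + V x ≤ φ σ + V σ := fun x hx =>
      le_of_hasDerivAt_nonneg (f := fun t => φ t + V t) hx fun t ht => by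
        obtain ⟨d, hd0, hd⟩ := hgrow t ht.2
        refine ⟨_, ?_, hd.add (S.hasDerivAt_V t (ht.2.trans_lt hσ0))⟩
        have : Z t / (p * N) ≤ φ t := by
          rw [div_le_iff₀ (by linarith)]
          nlinarith [hφ0 t ht.2, hZ2 t ht.2]
        rw [neg_div]
        linarith
    have := le_of_tendsto (S.tendsto_phi.add S.tendsto_V)
      ((eventually_le_atBot σ).mono hmono)
    linarith
  have hθσ : θ ≤ φ σ := by
    by_contra hlt
    have h1 := hcφ.eventually_lt_const (not_le.1 hlt)
    have h2 := hcV.eventually_const_lt (show 1 - ε < V σ by linarith)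
    have h3 := hcZ.eventually_lt_const (show Z σ < 1 / 4 by linarith [hZ2 σ le_rfl])
    obtain ⟨δ, hδ, hball⟩ := Metric.eventually_nhds_iff.1 (h1.and (h2.and h3))
    obtain ⟨y, hyA, hy⟩ := exists_lt_of_csInf_lt hne (show σ < σ + δ by linarith)
    have hσy := csInf_le hbdd hyA
    obtain ⟨g1, g2, g3⟩ := hball (show dist y σ < δ by
      rw [Real.dist_eq, abs_of_nonneg (by linarith)]; linarith)
    rcases hyA.2 with h | h | h <;> linarith
  have := hZ2 σ le_rfl
  exact ⟨σ, hσ0, le_antisymm hφσ hθσ, by linarith, by linarith⟩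

end FastSlow

/-! ### Passage through a bubble -/

theorem mul_exp_le_of_hasDerivAt {f : ℝ → ℝ} {m a b : ℝ} (hab : a ≤ b)
    (h : ∀ x ∈ Icc a b, ∃ d, m * f x ≤ d ∧ HasDerivAt f d x) :
    f a * Real.exp (m * (b - a)) ≤ f b := by
  have := le_of_hasDerivAt_nonneg (f := fun t => f t * Real.exp (m * (b - t))) hab fun t ht => by
    obtain ⟨d, h0, hd⟩ := h t ht
    refine ⟨(d - m * f t) * Real.exp (m * (b - t)),
      mul_nonneg (by linarith) (Real.exp_pos _).le, ?_⟩
    have he : HasDerivAt (fun t => Real.exp (m * (b - t))) (Real.exp (m * (b - t)) * (m * (-1))) t :=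
      (((hasDerivAt_id t).const_sub b).const_mul m).exp
    refine (hd.fun_mul he).congr_deriv ?_
    ring
  simpa using this

theorem le_mul_exp_of_hasDerivAt {f : ℝ → ℝ} {m a b : ℝ} (hab : a ≤ b)
    (h : ∀ x ∈ Icc a b, ∃ d, d ≤ m * f x ∧ HasDerivAt f d x) :
    f b ≤ f a * Real.exp (m * (b - a)) := by
  have := mul_exp_le_of_hasDerivAt (f := fun x => -f x) (m := m) hab fun x hx => by
    obtain ⟨d, h0, hd⟩ := h x hx
    exact ⟨-d, by linarith, hd.neg⟩
  linarith

namespace FastSlow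

variable {p N ρ : ℝ} {V Z φ : ℝ → ℝ}

/-- While `V ^ (p - 1)` stays close to a constant `D`, the energy `φ + (2 - D Z) ^ 2 / 2` is almost
conserved; its variation is controlled by the variation of the monotone quantity `Z`, not by the
elapsed time. -/
theorem abs_energy_sub_le (S : FastSlow p N ρ V Z φ) {σ x D ε : ℝ} (hσx : σ ≤ x) (hx : x < 0)
    (hD : 0 < D) (hε : ε ≤ 1 / 100) (hρε : ρ ≤ ε)
    (hV : ∀ t ∈ Icc σ x, ρ ≤ V t ∧ |V t ^ (p - 1) - D| ≤ ε * D) :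
    |(φ x + (2 - D * Z x) ^ 2 / 2) - (φ σ + (2 - D * Z σ) ^ 2 / 2)|
      ≤ 7 * ε * ((D * Z x + (D * Z x) ^ 2 / 2) - (D * Z σ + (D * Z σ) ^ 2 / 2)) := by
  have hder : ∀ t ∈ Icc σ x, ∃ d g : ℝ, |d| ≤ 7 * ε * g ∧
      HasDerivAt (fun t => φ t + (2 - D * Z t) ^ 2 / 2) d t ∧
      HasDerivAt (fun t => D * Z t + (D * Z t) ^ 2 / 2) g t := by
    intro t ht
    have ht0 := ht.2.trans_lt hx
    obtain ⟨hρ, hvD⟩ := hV t ht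
    obtain ⟨η, hη, hd⟩ := S.hasDerivAt_phi t ht0 hρ
    have hz := S.hasDerivAt_Z t ht0
    set v := V t ^ (p - 1) with hv
    have hv0 : 0 < v := Real.rpow_pos_of_pos (S.V_pos t ht0) _
    have hz1 := (hz.const_mul D)
    refine ⟨φ t * (2 - v * Z t * (1 + η)) - (2 - D * Z t) * (D * (φ t / v)),
      (1 + D * Z t) * (D * (φ t / v)), ?_, ?_, ?_⟩
    · have hZ0 := S.Z_nonneg t ht0
      have hφ0 : 0 ≤ φ t / v := div_nonneg (S.phi_nonneg t ht0) hv0.le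
      have e1 : φ t * (2 - v * Z t * (1 + η)) - (2 - D * Z t) * (D * (φ t / v))
          = φ t / v * (2 * (v - D) + Z t * ((D - v) * (D + v) - v ^ 2 * η)) := by
        field_simp; ring
      have e2 : 7 * ε * ((1 + D * Z t) * (D * (φ t / v)))
          = φ t / v * (7 * ε * D + Z t * (7 * ε * D ^ 2)) := by ring
      rw [e1, e2, abs_mul, abs_of_nonneg hφ0]
      have hε0 : 0 ≤ ε := by
        have := (abs_nonneg _).trans hvD
        exact nonneg_of_mul_nonneg_left this hD
      have hvle : v ≤ 1.01 * D := by nlinarith [(abs_le.1 hvD).2]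
      have h1 : |(D - v) * (D + v)| ≤ 3 * ε * D ^ 2 := by
        rw [abs_mul, abs_sub_comm, abs_of_pos (by linarith : 0 < D + v)]
        nlinarith [mul_nonneg hε0 hD.le, abs_nonneg (v - D)]
      have h2 : |v ^ 2 * η| ≤ 4 * ε * D ^ 2 := by
        rw [abs_mul, abs_of_nonneg (sq_nonneg v)]
        have hv2 : v ^ 2 ≤ 4 * D ^ 2 := by nlinarith
        have := mul_le_mul hv2 (hη.trans hρε) (abs_nonneg η) (by positivity)
        linarith
      have h3 : |(D - v) * (D + v) - v ^ 2 * η| ≤ 7 * ε * D ^ 2 :=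
        (abs_sub _ _).trans (by linarith)
      refine mul_le_mul_of_nonneg_left ?_ hφ0
      refine (abs_add_le _ _).trans (add_le_add ?_ ?_)
      · rw [abs_mul, abs_two]
        nlinarith [mul_nonneg hε0 hD.le]
      · rw [abs_mul, abs_of_nonneg hZ0]
        exact mul_le_mul_of_nonneg_left h3 hZ0
    · refine (hd.fun_add (((hz1.const_sub 2).fun_pow 2).div_const 2)).congr_deriv ?_
      push_cast; ring
    · refine (hz1.fun_add ((hz1.fun_pow 2).div_const 2)).congr_deriv ?_
      push_cast; ring
  have up := le_of_hasDerivAt_nonneg (f := fun t => 7 * ε * (D * Z t + (D * Z t) ^ 2 / 2)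
      - (φ t + (2 - D * Z t) ^ 2 / 2)) hσx fun t ht => by
    obtain ⟨d, g, hdg, h1, h2⟩ := hder t ht
    exact ⟨_, by linarith [(abs_le.1 hdg).2], (h2.const_mul (7 * ε)).fun_sub h1⟩
  have lo := le_of_hasDerivAt_nonneg (f := fun t => 7 * ε * (D * Z t + (D * Z t) ^ 2 / 2)
      + (φ t + (2 - D * Z t) ^ 2 / 2)) hσx fun t ht => by
    obtain ⟨d, g, hdg, h1, h2⟩ := hder t ht
    exact ⟨_, by linarith [(abs_le.1 hdg).1], (h2.const_mul (7 * ε)).fun_add h1⟩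
  rw [abs_le]
  constructor <;> linarith

/-- The almost conserved energy bounds `D Z` without any prior bound, since the error in
`abs_energy_sub_le` is a small multiple of a quadratic polynomial in `D Z`. -/
theorem energy_bounds (S : FastSlow p N ρ V Z φ) {σ x D a ε : ℝ} (hσx : σ ≤ x) (hx : x < 0)
    (hD : 0 < D) (ha0 : 0 < a) (ha2 : a ≤ 2) (hε0 : 0 < ε) (hεa : 1040 * ε ≤ a ^ 2)
    (hρε : ρ ≤ ε) (hV : ∀ t ∈ Icc σ x, ρ ≤ V t ∧ |V t ^ (p - 1) - D| ≤ ε * D)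
    (hY : |D * Z σ - (2 - a)| ≤ ε) (hφ : φ σ ≤ ε) :
    D * Z x ≤ 5 ∧ |φ x + (2 - D * Z x) ^ 2 / 2 - a ^ 2 / 2| ≤ 130 * ε := by
  have hε : ε ≤ 1 / 100 := by nlinarith
  have hE := abs_energy_sub_le S hσx hx hD hε hρε hV
  have hσ0 := hσx.trans_lt hx
  have hφσ := S.phi_nonneg σ hσ0
  have hφx := S.phi_nonneg x hx
  have hYσ : 0 ≤ D * Z σ := mul_nonneg hD.le (S.Z_nonneg σ hσ0)
  have hYx : 0 ≤ D * Z x := mul_nonneg hD.le (S.Z_nonneg x hx)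
  set Y := D * Z x
  set Y0 := D * Z σ
  have hY' := abs_le.1 hY
  have hsq : |(2 - Y0) ^ 2 - a ^ 2| ≤ 5 * ε := by
    rw [show (2 - Y0) ^ 2 - a ^ 2 = (Y0 - (2 - a)) * (Y0 - 2 - a) by ring, abs_mul, mul_comm]
    have : |Y0 - 2 - a| ≤ 5 := by rw [abs_le]; constructor <;> linarith
    exact mul_le_mul this hY (abs_nonneg _) (by norm_num)
  have hsq' := abs_le.1 hsq
  have hY0sq : 0 ≤ Y0 + Y0 ^ 2 / 2 := by positivity
  have hE' := abs_le.1 hE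
  have ha4 : a ^ 2 ≤ 4 := by nlinarith
  have h5 : Y ≤ 5 := by
    by_contra hlt
    push Not at hlt
    have h1 : 7 * ε * (Y + Y ^ 2 / 2 - (Y0 + Y0 ^ 2 / 2)) ≤ 7 / 100 * (Y + Y ^ 2 / 2) :=
      mul_le_mul (by linarith) (by linarith)
        (nonneg_of_mul_nonneg_right ((abs_nonneg _).trans hE) (by linarith)) (by norm_num)
    have h2 : (2 - Y) ^ 2 / 2 ≤ 2.1 + 7 / 100 * (Y + Y ^ 2 / 2) := by linarith
    have h3 : 0 < (Y - 5) * Y := mul_pos (by linarith) (by linarith)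
    linarith
  refine ⟨h5, ?_⟩
  have hq : Y + Y ^ 2 / 2 - (Y0 + Y0 ^ 2 / 2) ≤ 35 / 2 := by
    have : Y ^ 2 ≤ 5 ^ 2 := by gcongr
    linarith
  have := mul_le_mul_of_nonneg_left hq (show 0 ≤ 7 * ε by linarith)
  rw [abs_le]
  constructor <;> linarith

/-- The passage through one bubble: starting with `D Z ≈ 2 - a` and `φ = θ`, within a time of
order `log (1 / θ)` the solution reaches the centre `D Z = 2`, where `φ ≈ a ^ 2 / 2`, and then
comes back to `φ = θ` with `D Z ≈ 2 + a`. -/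
theorem bubble_passage (S : FastSlow p N ρ V Z φ) {σ e D a ε θ : ℝ} (he : e < 0)
    (hD : 0 < D) (ha0 : 0 < a) (ha2 : a ≤ 2) (hε0 : 0 < ε) (hεa : 1040 * ε ≤ a ^ 2)
    (hρε : ρ ≤ ε) (hV : ∀ t ∈ Icc σ e, ρ ≤ V t ∧ |V t ^ (p - 1) - D| ≤ ε * D)
    (hY : |D * Z σ - (2 - a)| ≤ ε) (hφ : φ σ = θ) (hθ0 : 0 < θ) (hθε : θ ≤ ε)
    (htime : 2 * (4 / a * Real.log (4 / θ)) + 8 / a ≤ e - σ) :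
    ∃ c ∈ Icc σ e, ∃ τ ∈ Icc σ e, D * Z c = 2 ∧ |φ c - a ^ 2 / 2| ≤ 130 * ε ∧ φ τ = θ ∧
      |D * Z τ - (2 + a)| ≤ 262 * ε / a := by
  have hε : ε ≤ 1 / 100 := by nlinarith
  set L := 4 / a * Real.log (4 / θ) with hL
  have h8 : 0 < 8 / a := by positivity
  have hL0 : 0 < L := mul_pos (by positivity) (Real.log_pos (by rw [lt_div_iff₀ hθ0]; linarith))
  have hexp : Real.exp (a / 4 * L) = 4 / θ := by
    rw [hL, show a / 4 * (4 / a * Real.log (4 / θ)) = Real.log (4 / θ) by field_simp,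
      Real.exp_log (by positivity)]
  have hB : ∀ x ∈ Icc σ e, D * Z x ≤ 5 ∧
      |φ x + (2 - D * Z x) ^ 2 / 2 - a ^ 2 / 2| ≤ 130 * ε := fun x hx =>
    S.energy_bounds hx.1 (hx.2.trans_lt he) hD ha0 ha2 hε0 hεa hρε
      (fun t ht => hV t ⟨ht.1, ht.2.trans hx.2⟩) hY (hφ.trans_le hθε)
  have hφ4 : ∀ x ∈ Icc σ e, φ x < 4 := fun x hx => by
    nlinarith [(abs_le.1 (hB x hx).2).2, sq_nonneg (2 - D * Z x)]
  have hφ0 : ∀ x ∈ Icc σ e, 0 ≤ φ x := fun x hx => S.phi_nonneg x (hx.2.trans_lt he)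
  have hmono : ∀ x y, x ≤ y → y ≤ e → D * Z x ≤ D * Z y := fun x y hxy hy =>
    mul_le_mul_of_nonneg_left (S.Z_le hxy (hy.trans_lt he)) hD.le
  have hcZ : ContinuousOn (fun x => D * Z x) (Icc σ e) := fun x hx =>
    ((S.hasDerivAt_Z x (hx.2.trans_lt he)).continuousAt.const_mul D).continuousWithinAt
  have hcφ : ContinuousOn φ (Icc σ e) := fun x hx =>
    (S.continuousAt_phi (hx.2.trans_lt he) (hV x hx).1).continuousWithinAt
  -- the logarithmic derivative of `φ` is `2 - D Z`, up to a small error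
  have hrate : ∀ x ∈ Icc σ e, ∃ m, |m - (2 - D * Z x)| ≤ 20 * ε ∧ HasDerivAt φ (φ x * m) x := by
    intro x hx
    have hx0 := hx.2.trans_lt he
    obtain ⟨hρ, hv⟩ := hV x hx
    obtain ⟨η, hη, hd⟩ := S.hasDerivAt_phi x hx0 hρ
    refine ⟨_, ?_, hd⟩
    have hz0 := S.Z_nonneg x hx0
    have h5 := (hB x hx).1
    have hη' := hη.trans hρε
    have e1 : 2 - V x ^ (p - 1) * Z x * (1 + η) - (2 - D * Z x)
        = -((V x ^ (p - 1) - D) * Z x * (1 + η)) - D * Z x * η := by ring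
    have h1 : |1 + η| ≤ 2 := by
      have := abs_le.1 hη'
      rw [abs_le]; constructor <;> linarith
    have h2 : |(V x ^ (p - 1) - D) * Z x * (1 + η)| ≤ 10 * ε := by
      rw [abs_mul, abs_mul, abs_of_nonneg hz0]
      have h3 : |V x ^ (p - 1) - D| * Z x ≤ 5 * ε := by nlinarith
      have := mul_le_mul h3 h1 (abs_nonneg _) (by linarith)
      linarith
    have h4 : |D * Z x * η| ≤ 5 * ε := by
      rw [abs_mul, abs_of_nonneg (mul_nonneg hD.le hz0)]
      have := mul_le_mul h5 hη' (abs_nonneg _) (by norm_num)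
      linarith
    rw [e1]
    refine (abs_sub _ _).trans ?_
    rw [abs_neg]
    linarith
  have h20 : 20 * ε ≤ a / 4 := by nlinarith
  have hxA : σ + L ∈ Icc σ e := ⟨by linarith, by linarith⟩
  have hxB : σ + L + 8 / a ∈ Icc σ e := ⟨by linarith, by linarith⟩
  -- exponential growth of `φ` brings `D Z` up to `2 - a / 2`
  have hA : 2 - a / 2 ≤ D * Z (σ + L) := by
    by_contra hlt
    push Not at hlt
    have := mul_exp_le_of_hasDerivAt (f := φ) (m := a / 4) (show σ ≤ σ + L by linarith)
      fun x hx => by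
        have hxe : x ∈ Icc σ e := ⟨hx.1, hx.2.trans hxA.2⟩
        obtain ⟨m, hm, hd⟩ := hrate x hxe
        refine ⟨_, ?_, hd⟩
        have h1 := hmono x (σ + L) hx.2 hxA.2
        have h2 := (abs_le.1 hm).1
        rw [mul_comm]
        exact mul_le_mul_of_nonneg_left (by linarith) (hφ0 x hxe)
    rw [add_sub_cancel_left, hexp, hφ, mul_div_cancel₀ _ hθ0.ne'] at this
    linarith [hφ4 _ hxA]
  -- in the core of the bubble `φ` is bounded below, so `D Z` increases to `2 + a / 2`
  have hBB : 2 + a / 2 ≤ D * Z (σ + L + 8 / a) := by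
    by_contra hlt
    push Not at hlt
    have := le_of_hasDerivAt_nonneg (f := fun x => D * Z x - a ^ 2 / 8 * x)
      (show σ + L ≤ σ + L + 8 / a by linarith) fun x hx => by
        have hxe : x ∈ Icc σ e := ⟨hxA.1.trans hx.1, hx.2.trans hxB.2⟩
        have hx0 := hxe.2.trans_lt he
        refine ⟨_, ?_, ((S.hasDerivAt_Z x hx0).const_mul D).fun_sub
          ((hasDerivAt_id x).const_mul (a ^ 2 / 8))⟩
        have h1 := hmono x _ hx.2 hxB.2
        have h2 := hmono _ x hx.1 hxe.2
        have h3 := (abs_le.1 (hB x hxe).2).1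
        have hsq : (2 - D * Z x) ^ 2 ≤ (a / 2) ^ 2 := sq_le_sq' (by linarith) (by linarith)
        have h4 : a ^ 2 / 4 ≤ φ x := by nlinarith
        have hv0 := Real.rpow_pos_of_pos (S.V_pos x hx0) (p - 1)
        have hv : V x ^ (p - 1) ≤ 2 * D := by nlinarith [(abs_le.1 (hV x hxe).2).2]
        have h5 : a ^ 2 / 8 ≤ D * (φ x / V x ^ (p - 1)) := by
          rw [← mul_div_assoc, le_div_iff₀ hv0]
          nlinarith [mul_nonneg hD.le (sub_nonneg.2 h4), mul_nonneg (sq_nonneg a) (sub_nonneg.2 hv)]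
        linarith
    have e8 : a ^ 2 / 8 * (8 / a) = a := by field_simp
    have : a ^ 2 / 8 * (σ + L + 8 / a) = a ^ 2 / 8 * (σ + L) + a := by rw [mul_add, e8]
    linarith
  obtain ⟨b, hb, hYb⟩ := intermediate_value_Icc hxB.1 (hcZ.mono (Icc_subset_Icc_right hxB.2))
    (show 2 + a / 2 ∈ Icc (D * Z σ) (D * Z (σ + L + 8 / a)) from
      ⟨by nlinarith [(abs_le.1 hY).2], hBB⟩)
  obtain ⟨c, hc, hYc⟩ := intermediate_value_Icc hxB.1 (hcZ.mono (Icc_subset_Icc_right hxB.2))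
    (show (2 : ℝ) ∈ Icc (D * Z σ) (D * Z (σ + L + 8 / a)) from
      ⟨by nlinarith [(abs_le.1 hY).2], by linarith⟩)
  simp only at hYb hYc
  have hce : c ∈ Icc σ e := ⟨hc.1, hc.2.trans hxB.2⟩
  have hbe : b ∈ Icc σ e := ⟨hb.1, hb.2.trans hxB.2⟩
  have hbLe : b + L ∈ Icc σ e := ⟨by linarith [hb.1], by linarith [hb.2]⟩
  -- afterwards `φ` decays exponentially
  have hC : φ (b + L) ≤ θ := by
    have := le_mul_exp_of_hasDerivAt (f := φ) (m := -(a / 4)) (show b ≤ b + L by linarith)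
      fun x hx => by
        have hxe : x ∈ Icc σ e := ⟨hb.1.trans hx.1, hx.2.trans hbLe.2⟩
        obtain ⟨m, hm, hd⟩ := hrate x hxe
        refine ⟨_, ?_, hd⟩
        have h1 := hmono b x hx.1 hxe.2
        have h2 := (abs_le.1 hm).2
        rw [mul_comm _ (φ x)]
        exact mul_le_mul_of_nonneg_left (by linarith) (hφ0 x hxe)
    rw [add_sub_cancel_left, neg_mul, Real.exp_neg, hexp, inv_div] at this
    nlinarith [hφ4 b hbe]
  have hφb : θ ≤ φ b := by
    have h3 := (abs_le.1 (hB b hbe).2).1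
    rw [hYb] at h3
    nlinarith
  obtain ⟨τ, hτ, hφτ⟩ := intermediate_value_Icc' (show b ≤ b + L by linarith)
    (hcφ.mono (Icc_subset_Icc hb.1 hbLe.2)) ⟨hC, hφb⟩
  have hτe : τ ∈ Icc σ e := ⟨hb.1.trans hτ.1, hτ.2.trans hbLe.2⟩
  refine ⟨c, hce, τ, hτe, hYc, ?_, hφτ, ?_⟩
  · have := (hB c hce).2
    rw [hYc] at this
    simpa using this
  · have hYτ := hmono b τ hτ.1 hτe.2
    have hEτ := abs_le.1 (hB τ hτe).2
    rw [hφτ] at hEτ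
    rw [hYb] at hYτ
    set Y := D * Z τ
    rw [le_div_iff₀ ha0]
    have h1 : |Y - (2 + a)| * (Y - 2 + a) ≤ 262 * ε := by
      have e : |Y - (2 + a)| * (Y - 2 + a) = |(2 - Y) ^ 2 - a ^ 2| := by
        rw [show (2 - Y) ^ 2 - a ^ 2 = (Y - (2 + a)) * (Y - 2 + a) by ring, abs_mul,
          abs_of_nonneg (show 0 ≤ Y - 2 + a by linarith)]
      rw [e, abs_le]
      constructor <;> linarith
    refine le_trans ?_ h1
    exact mul_le_mul_of_nonneg_left (by linarith) (abs_nonneg _)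

end FastSlow

/-! ### The flight between two bubbles -/

namespace FastSlow

variable {p N ρ : ℝ} {V Z φ : ℝ → ℝ}

/-- `log φ - 2 x - N V ^ p` varies by at most `ρ N`. -/
theorem abs_log_phi_sub_le (S : FastSlow p N ρ V Z φ) {x y : ℝ} (hxy : x ≤ y) (hy : y < 0)
    (hρ : ρ ≤ V y) :
    |Real.log (φ y) - Real.log (φ x) - 2 * (y - x) - N * (V y ^ p - V x ^ p)| ≤ ρ * N := by
  have hVy : ∀ t ∈ Icc x y, ρ ≤ V t := fun t ht =>
    hρ.trans (S.antitoneOn_V (ht.2.trans hy.le) hy.le ht.2)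
  have hN := S.N_pos
  have hp := S.one_lt
  have hder : ∀ t ∈ Icc x y, ∃ d g : ℝ, |d| ≤ -(ρ * g) ∧
      HasDerivAt (fun t => Real.log (φ t) - 2 * t - N * V t ^ p) d t ∧
      HasDerivAt (fun t => N * V t ^ p) g t := by
    intro t ht
    have ht0 := ht.2.trans_lt hy
    obtain ⟨η, hη, hd⟩ := S.hasDerivAt_phi t ht0 (hVy t ht)
    have hφ := S.phi_pos t ht0 (hVy t ht)
    have hV0 := S.V_pos t ht0
    have hvp := Real.rpow_pos_of_pos hV0 (p - 1)
    have hVp : HasDerivAt (fun t => N * V t ^ p) (-(V t ^ (p - 1) * Z t)) t := by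
      refine (((S.hasDerivAt_V t ht0).rpow_const (p := p) (Or.inl hV0.ne')).const_mul N).congr_deriv ?_
      have : p ≠ 0 := by linarith
      field_simp
    refine ⟨-(V t ^ (p - 1) * Z t * η), _, ?_, ?_, hVp⟩
    · rw [abs_neg, abs_mul, abs_of_nonneg (mul_nonneg hvp.le (S.Z_nonneg t ht0))]
      have := mul_le_mul_of_nonneg_left hη (mul_nonneg hvp.le (S.Z_nonneg t ht0))
      linarith
    · refine (((hd.log hφ.ne').fun_sub ((hasDerivAt_id t).const_mul 2)).fun_sub hVp).congr_deriv ?_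
      rw [mul_div_cancel_left₀ _ hφ.ne']
      ring
  have hρ0 : 0 ≤ ρ := by
    obtain ⟨η, hη, -⟩ := S.hasDerivAt_phi y hy hρ
    exact (abs_nonneg η).trans hη
  have up := le_of_hasDerivAt_nonpos (f := fun t => ρ * (N * V t ^ p)
      + (Real.log (φ t) - 2 * t - N * V t ^ p)) hxy fun t ht => by
    obtain ⟨d, g, hdg, h1, h2⟩ := hder t ht
    exact ⟨_, by linarith [(abs_le.1 hdg).2], (h2.const_mul ρ).fun_add h1⟩
  have lo := le_of_hasDerivAt_nonpos (f := fun t => ρ * (N * V t ^ p)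
      - (Real.log (φ t) - 2 * t - N * V t ^ p)) hxy fun t ht => by
    obtain ⟨d, g, hdg, h1, h2⟩ := hder t ht
    exact ⟨_, by linarith [(abs_le.1 hdg).1], (h2.const_mul ρ).fun_sub h1⟩
  have hx0 := hxy.trans_lt hy
  have hx1 : V x ^ p ≤ 1 := Real.rpow_le_one (S.V_pos x hx0).le (S.V_le_one x hx0) (by linarith)
  have hy1 : 0 ≤ V y ^ p := (Real.rpow_pos_of_pos (S.V_pos y hy) p).le
  have b1 : ρ * (N * V x ^ p) ≤ ρ * N := by
    have := mul_le_mul_of_nonneg_left hx1 (mul_nonneg hρ0 hN.le)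
    linarith
  have b2 : 0 ≤ ρ * (N * V y ^ p) := by positivity
  rw [abs_le]
  constructor <;> linarith

/-- The flight between two bubbles. Starting with `φ = θ` decreasing, `φ` stays below `θ` until it
is back at the level `θ` or `V` has dropped to a prescribed value `v₃`; meanwhile `Z` is almost
constant and `log φ` is almost a function of `V`. -/
theorem exists_flight_end (S : FastSlow p N ρ V Z φ) {τ v₂ v₃ θ : ℝ} (hτ : τ < 0) (hv₃ : 0 < v₃)
    (hρv : ρ ≤ v₃) (h₃₂ : v₃ < v₂) (h₂ : v₂ < V τ) (hφ : φ τ = θ) (hρ1 : ρ ≤ 1)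
    (hrate : 2 < v₂ ^ (p - 1) * Z τ * (1 - ρ)) :
    ∃ e, τ < e ∧ e < 0 ∧ v₃ ≤ V e ∧ V e ≤ v₂ ∧ φ e ≤ θ ∧ (φ e = θ ∨ V e = v₃) ∧
      Z e ≤ Z τ + θ / v₃ ^ (p - 1) * (e - τ) ∧
      |Real.log (φ e) - Real.log θ - 2 * (e - τ) - N * (V e ^ p - V τ ^ p)| ≤ ρ * N := by
  have hp := S.one_lt
  obtain ⟨e₂, hτ2, he₂, hVe₂⟩ := S.exists_V_eq hτ (hv₃.trans h₃₂) h₂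
  obtain ⟨e₃, h23, he₃, hVe₃⟩ := S.exists_V_eq he₂ hv₃ (by rw [hVe₂]; exact h₃₂)
  have hV3 : ∀ x ≤ e₃, v₃ ≤ V x := fun x hx =>
    hVe₃ ▸ S.antitoneOn_V (hx.trans he₃.le) he₃.le hx
  have hV2 : ∀ x ≤ e₂, v₂ ≤ V x := fun x hx =>
    hVe₂ ▸ S.antitoneOn_V (hx.trans he₂.le) he₂.le hx
  have hφpos : ∀ x ≤ e₃, 0 < φ x := fun x hx =>
    S.phi_pos x (hx.trans_lt he₃) (hρv.trans (hV3 x hx))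
  have hdec : ∀ y ∈ Icc τ e₂, ∃ d, d < 0 ∧ HasDerivAt φ d y := by
    intro y hy
    have hy0 := hy.2.trans_lt he₂
    obtain ⟨η, hη, hd⟩ := S.hasDerivAt_phi y hy0 (hρv.trans (hV3 y (hy.2.trans h23.le)))
    refine ⟨_, mul_neg_of_pos_of_neg (hφpos y (hy.2.trans h23.le)) ?_, hd⟩
    have h1 : v₂ ^ (p - 1) ≤ V y ^ (p - 1) :=
      Real.rpow_le_rpow (hv₃.trans h₃₂).le (hV2 y hy.2) (by linarith)
    have h2 := S.Z_le hy.1 hy0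
    have h3 : 1 - ρ ≤ 1 + η := by linarith [(abs_le.1 hη).1]
    have hz := S.Z_nonneg τ hτ
    have h4 : v₂ ^ (p - 1) * Z τ ≤ V y ^ (p - 1) * Z y :=
      mul_le_mul h1 h2 hz (h1.trans' (Real.rpow_nonneg (hv₃.trans h₃₂).le _))
    have h5 := mul_le_mul h4 h3 (by linarith) (h4.trans'
      (mul_nonneg (Real.rpow_nonneg (hv₃.trans h₃₂).le _) hz))
    linarith
  have hanti : StrictAntiOn φ (Icc τ e₂) := by
    apply strictAntiOn_of_deriv_neg (convex_Icc τ e₂)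
    · intro x hx
      obtain ⟨d, -, hd⟩ := hdec x hx
      exact hd.continuousAt.continuousWithinAt
    · intro x hx
      obtain ⟨d, h0, hd⟩ := hdec x (interior_subset hx)
      rw [hd.deriv]; exact h0
  have hφe₂ : φ e₂ < θ := hφ ▸ hanti (left_mem_Icc.2 hτ2.le) (right_mem_Icc.2 hτ2.le) hτ2
  have hcφ : ContinuousOn φ (Icc e₂ e₃) := fun x hx =>
    (S.continuousAt_phi (hx.2.trans_lt he₃) (hρv.trans (hV3 x hx.2))).continuousWithinAt
  -- the first return to the level `θ` if there is one before `V` reaches `v₃`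
  have hmain : ∃ e ∈ Icc e₂ e₃, (∀ x ∈ Icc e₂ e, φ x ≤ θ) ∧ (φ e = θ ∨ V e = v₃) := by
    set A : Set ℝ := Icc e₂ e₃ ∩ φ ⁻¹' (Ici θ)
    have hAc : IsClosed A := hcφ.preimage_isClosed_of_isClosed isClosed_Icc isClosed_Ici
    have hAb : BddBelow A := ⟨e₂, fun x hx => hx.1.1⟩
    rcases A.eq_empty_or_nonempty with hA | hA
    · refine ⟨e₃, right_mem_Icc.2 h23.le, fun x hx => ?_, Or.inr hVe₃⟩
      by_contra hlt
      have : x ∈ A := ⟨hx, (not_le.1 hlt).le⟩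
      rw [hA] at this
      exact this
    · have hmem := hAc.csInf_mem hA hAb
      set e := sInf A
      have hlt : ∀ x ∈ Icc e₂ e, x < e → φ x < θ := by
        intro x hx hxe
        by_contra hge
        exact absurd (csInf_le hAb ⟨⟨hx.1, hx.2.trans hmem.1.2⟩, not_lt.1 hge⟩) (not_le.2 hxe)
      have he2 : e₂ < e := by
        rcases hmem.1.1.eq_or_lt with h | h
        · exact absurd hmem.2 (by rw [← h]; exact not_le.2 hφe₂)
        · exact h
      have hself : ∀ᶠ x in 𝓝[<] e, x ∈ Ioo e₂ e := Ioo_mem_nhdsLT he2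
      have hce := S.continuousAt_phi (hmem.1.2.trans_lt he₃) (hρv.trans (hV3 e hmem.1.2))
      have hle : φ e ≤ θ := le_of_tendsto (hce.tendsto.mono_left nhdsWithin_le_nhds)
        (hself.mono fun x hx => (hlt x ⟨hx.1.le, hx.2.le⟩ hx.2).le)
      refine ⟨e, hmem.1, fun x hx => ?_, Or.inl (le_antisymm hle hmem.2)⟩
      rcases hx.2.eq_or_lt with h | h
      · rw [h]; exact hle
      · exact (hlt x hx h).le
  obtain ⟨e, he, hle, hor⟩ := hmain
  have he0 := he.2.trans_lt he₃
  have hτe : τ < e := hτ2.trans_le he.1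
  have hφle : ∀ x ∈ Icc τ e, φ x ≤ θ := by
    intro x hx
    rcases le_total x e₂ with h | h
    · exact hφ ▸ hanti.antitoneOn (left_mem_Icc.2 hτ2.le) ⟨hx.1, h⟩ hx.1
    · exact hle x ⟨h, hx.2⟩
  refine ⟨e, hτe, he0, hV3 e he.2, hVe₂ ▸ S.antitoneOn_V he₂.le he0.le he.1,
    hφle e (right_mem_Icc.2 hτe.le), hor, ?_, ?_⟩
  · have := le_of_hasDerivAt_nonneg (f := fun t => θ / v₃ ^ (p - 1) * t - Z t) hτe.le fun t ht => by
      have ht0 := ht.2.trans_lt he0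
      refine ⟨_, ?_, ((hasDerivAt_id t).const_mul (θ / v₃ ^ (p - 1))).fun_sub (S.hasDerivAt_Z t ht0)⟩
      have h1 : v₃ ^ (p - 1) ≤ V t ^ (p - 1) :=
        Real.rpow_le_rpow hv₃.le (hV3 t (ht.2.trans he.2)) (by linarith)
      have h2 := div_le_div₀ ((S.phi_nonneg t ht0).trans (hφle t ht)) (hφle t ht)
        (Real.rpow_pos_of_pos hv₃ _) h1
      linarith
    linarith
  · have := S.abs_log_phi_sub_le hτe.le he0 (hρv.trans (hV3 e he.2))
    rwa [hφ] at this

end FastSlow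

/-! ### Induction over the bubbles -/

/-- Between two bubbles: for large `n` the `n`-th solution has a point at which `V` is close to `δ`,
`δ ^ (p - 1) Z` is close to `s`, and `φ` has decayed to `1 / N ^ 2`. The level `1 / N ^ 2` is so
small that `φ` is negligible over times of order `N`, and still so large that a time of order
`log N` suffices to leave it. -/
def HasQuietPoints (p : ℝ) (N : ℕ → ℝ) (V Z φ : ℕ → ℝ → ℝ) (δ s : ℝ) : Prop :=
  ∀ ε > 0, ∀ᶠ n in atTop, ∃ x < 0, |V n x - δ| < ε ∧ |δ ^ (p - 1) * Z n x - s| < ε ∧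
    φ n x = 1 / N n ^ 2

/-- For large `n` the `n`-th solution has a point at which it is close to the centre of a bubble
with parameters `δ` and `a`. -/
def HasCentres (p : ℝ) (V Z φ : ℕ → ℝ → ℝ) (δ a : ℝ) : Prop :=
  ∀ ε > 0, ∀ᶠ n in atTop, ∃ x < 0, |V n x - δ| < ε ∧ |δ ^ (p - 1) * Z n x - 2| < ε ∧
    |φ n x - a ^ 2 / 2| < ε

theorem eventually_log_le {A B c : ℝ} (hc : 0 < c) :
    ∀ᶠ x : ℝ in atTop, A * Real.log (4 / (1 / x ^ 2)) + B ≤ c * x := by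
  have h1 : (fun x : ℝ => A * (Real.log 4 + 2 * Real.log x) + B) =o[atTop] (fun x : ℝ => x) := by
    have hl := Real.isLittleO_log_id_atTop
    have hconst : ∀ b : ℝ, (fun _ : ℝ => b) =o[atTop] (fun x : ℝ => x) := fun b =>
      Asymptotics.isLittleO_const_left.2 (Or.inr (tendsto_norm_atTop_atTop))
    exact (((hconst (Real.log 4)).add (hl.const_mul_left 2)).const_mul_left A).add (hconst B)
  filter_upwards [h1.bound hc, eventually_gt_atTop 0] with x hx hx0
  have e : Real.log (4 / (1 / x ^ 2)) = Real.log 4 + 2 * Real.log x := by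
    rw [div_div_eq_mul_div, div_one, Real.log_mul (by norm_num) (by positivity), Real.log_pow]
    norm_num
  rw [e]
  rw [Real.norm_of_nonneg hx0.le] at hx
  exact (le_abs_self _).trans hx

theorem exists_rpow_near {q δ ε : ℝ} (hδ : 0 < δ) (hε : 0 < ε) :
    ∃ r > 0, r < δ ∧ ∀ v, |v - δ| ≤ r → |v ^ q - δ ^ q| ≤ ε := by
  have hc := (Real.continuousAt_rpow_const δ q (Or.inl hδ.ne'))
  obtain ⟨r, hr, h⟩ := Metric.continuousAt_iff.1 hc ε hε
  refine ⟨min (r / 2) (δ / 2), by positivity, (min_le_right _ _).trans_lt (by linarith),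
    fun v hv => (h (x := v) ?_).le⟩
  rw [Real.dist_eq]
  exact (hv.trans (min_le_left _ _)).trans_lt (by linarith)

section

variable {p : ℝ} {N : ℕ → ℝ} {V Z φ : ℕ → ℝ → ℝ}

theorem hasQuietPoints_one (hp : 1 < p) (hN : Tendsto N atTop atTop)
    (hS : ∀ ρ > 0, ∀ᶠ n in atTop, FastSlow p (N n) ρ (V n) (Z n) (φ n)) :
    HasQuietPoints p N V Z φ 1 0 := by
  intro ε hε
  obtain ⟨r, hr0, hr1, hr⟩ := exists_rpow_near (q := p - 1) one_pos (show (0 : ℝ) < 1 / 2 by norm_num)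
  set ε' := min r (min ε (1 / 2)) with hε'
  have hε0 : 0 < ε' := by positivity
  have hr' : ε' ≤ r := min_le_left _ _
  have hεε : ε' ≤ ε := (min_le_right _ _).trans (min_le_left _ _)
  have hε2 : ε' ≤ 1 / 2 := (min_le_right _ _).trans (min_le_right _ _)
  have hθ : Tendsto (fun n => 1 / N n ^ 2) atTop (𝓝 0) :=
    (((tendsto_pow_atTop two_ne_zero).comp hN).inv_tendsto_atTop).congr fun n => by simp
  filter_upwards [hS (1 / 2) (by norm_num), hN.eventually_ge_atTop 2,
    hθ.eventually_lt_const (show 0 < ε' / 2 by linarith),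
    hθ.eventually_lt_const (show (0 : ℝ) < 1 / 8 by norm_num)] with n S hN2 hθ1 hθ2
  have hεp : 1 / 2 ≤ (1 - ε') ^ (p - 1) := by
    have := (abs_le.1 (hr (1 - ε') (by rw [abs_le]; constructor <;> linarith))).1
    rw [Real.one_rpow] at this
    linarith
  obtain ⟨σ, hσ, h1, h2, h3⟩ := S.exists_entry_first (ε := ε') (θ := 1 / N n ^ 2) (by linarith) hεp
    le_rfl (by linarith) (by positivity) (by linarith) hθ2 (by nlinarith)
  have := S.V_le_one σ hσ
  have := S.Z_nonneg σ hσ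
  refine ⟨σ, hσ, ?_, ?_, h1⟩
  · rw [abs_lt]; constructor <;> linarith
  · rw [Real.one_rpow, abs_lt]; constructor <;> linarith

/-- A quiet point on the upper side of a bubble is followed by the centre of the bubble and by a
quiet point on its lower side: the sign of `2 - δ ^ (p - 1) Z` is reversed. -/
theorem HasQuietPoints.bubble (hN : Tendsto N atTop atTop)
    (hS : ∀ ρ > 0, ∀ᶠ n in atTop, FastSlow p (N n) ρ (V n) (Z n) (φ n))
    {δ a : ℝ} (hδ : 0 < δ) (ha0 : 0 < a) (ha2 : a ≤ 2) (hp : 1 < p)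
    (h : HasQuietPoints p N V Z φ δ (2 - a)) :
    HasCentres p V Z φ δ a ∧ HasQuietPoints p N V Z φ δ (2 + a) := by
  suffices H : ∀ ε > 0, ∀ᶠ n in atTop, (∃ x < 0, |V n x - δ| < ε ∧ |δ ^ (p - 1) * Z n x - 2| < ε ∧
      |φ n x - a ^ 2 / 2| < ε) ∧ ∃ x < 0, |V n x - δ| < ε ∧ |δ ^ (p - 1) * Z n x - (2 + a)| < ε ∧
      φ n x = 1 / N n ^ 2 from
    ⟨fun ε hε => (H ε hε).mono fun _ h => h.1, fun ε hε => (H ε hε).mono fun _ h => h.2⟩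
  intro ε hε
  have hD := Real.rpow_pos_of_pos hδ (p - 1)
  set D := δ ^ (p - 1)
  obtain ⟨ε₁, hε₁, hεa, hε130, hε262⟩ : ∃ ε₁ > 0, 1040 * ε₁ ≤ a ^ 2 ∧ 130 * ε₁ < ε ∧
      262 * ε₁ / a < ε := by
    refine ⟨min (a ^ 2 / 1040) (min (ε / 260) (ε * a / 524)), by positivity, ?_, ?_, ?_⟩
    · have := min_le_left (a ^ 2 / 1040) (min (ε / 260) (ε * a / 524))
      linarith
    · have := (min_le_right (a ^ 2 / 1040) (min (ε / 260) (ε * a / 524))).trans (min_le_left _ _)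
      linarith
    · have := (min_le_right (a ^ 2 / 1040) (min (ε / 260) (ε * a / 524))).trans (min_le_right _ _)
      have h0 := mul_pos hε ha0
      rw [div_lt_iff₀ ha0]
      linarith
  obtain ⟨r₀, hr₀, hr₀δ, hr⟩ := exists_rpow_near (q := p - 1) hδ (mul_pos hε₁ hD)
  set r := min r₀ (ε / 2)
  have hr0 : 0 < r := by positivity
  have hrr : r ≤ r₀ := min_le_left _ _
  have hrε : r < ε := (min_le_right _ _).trans_lt (by linarith)
  have hθ : Tendsto (fun n => 1 / N n ^ 2) atTop (𝓝 0) :=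
    (((tendsto_pow_atTop two_ne_zero).comp hN).inv_tendsto_atTop).congr fun n => by simp
  filter_upwards [hS (min ε₁ (δ - r)) (lt_min hε₁ (by linarith)), hN.eventually_gt_atTop 0,
    h (min (r / 2) ε₁) (lt_min (by linarith) hε₁), hθ.eventually_le_const hε₁,
    hN.eventually (eventually_log_le (A := 8 / a) (B := 8 / a)
      (show 0 < D * p * r / 10 by positivity))] with n S hN0 hσ hθε hlog
  obtain ⟨σ, hσ0, hVσ, hZσ, hφσ⟩ := hσ
  have hVσ' := abs_lt.1 (hVσ.trans_le (min_le_left _ _))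
  have hZσ' := hZσ.le.trans (min_le_right _ _)
  obtain ⟨e, hσe, he, hVe⟩ := S.exists_V_eq hσ0 (v := δ - r) (by linarith) (by linarith)
  have hVr : ∀ t ∈ Icc σ e, |V n t - δ| ≤ r := by
    intro t ht
    have h1 := S.antitoneOn_V hσ0.le (ht.2.trans he.le) ht.1
    have h2 := S.antitoneOn_V (ht.2.trans he.le) he.le ht.2
    rw [abs_le]; constructor <;> linarith
  have hV : ∀ t ∈ Icc σ e, min ε₁ (δ - r) ≤ V n t ∧ |V n t ^ (p - 1) - D| ≤ ε₁ * D := fun t ht =>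
    ⟨(min_le_right _ _).trans (by linarith [(abs_le.1 (hVr t ht)).1]),
      hr _ ((hVr t ht).trans hrr)⟩
  have hθ0 : 0 < 1 / N n ^ 2 := by positivity
  have h5 := (S.energy_bounds hσe.le he hD ha0 ha2 hε₁ hεa (min_le_left _ _) hV hZσ'
    (hφσ.trans_le hθε)).1
  have htime : 2 * (4 / a * Real.log (4 / (1 / N n ^ 2))) + 8 / a ≤ e - σ := by
    have h1 := S.le_mul_Z hσe.le he (z := 5 / D) (by rw [le_div_iff₀ hD]; linarith)
    have h2 : p * N n * (r / 2) ≤ 5 / D * (e - σ) :=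
      (mul_le_mul_of_nonneg_left (by linarith) S.pN_pos.le).trans h1
    have h3 : D * (p * N n * (r / 2)) ≤ 5 * (e - σ) := by
      have := mul_le_mul_of_nonneg_left h2 hD.le
      rwa [← mul_assoc D (5 / D), mul_div_cancel₀ _ hD.ne'] at this
    have e8 : 2 * (4 / a * Real.log (4 / (1 / N n ^ 2)))
      = 8 / a * Real.log (4 / (1 / N n ^ 2)) := by ring
    rw [e8]
    linarith
  obtain ⟨c, hc, τ, hτ, h1, h2, h3, h4⟩ := S.bubble_passage he hD ha0 ha2 hε₁ hεa (min_le_left _ _)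
    hV hZσ' hφσ hθ0 hθε htime
  refine ⟨⟨c, hc.2.trans_lt he, (hVr c hc).trans_lt hrε, ?_, by linarith⟩,
    τ, hτ.2.trans_lt he, (hVr τ hτ).trans_lt hrε, by linarith, h3⟩
  rw [h1, sub_self, abs_zero]; exact hε

/-- The function governing `log φ / N` along a flight that leaves the bubble `(δ, a)`. It vanishes
on `(0, δ)` exactly at the height of the next bubble, and it is positive below it. -/
noncomputable def flightPotential (p δ a v : ℝ) : ℝ :=
  v ^ p - δ ^ p + 2 * p * δ ^ (p - 1) / (2 + a) * (δ - v)

theorem flightPotential_eq {δ a v : ℝ} (hδ : 0 < δ) (hv : 0 < v) :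
    flightPotential p δ a v = δ ^ p * (2 * p / (2 + a) * (1 - v / δ) - 1 + (v / δ) ^ p) := by
  have e : (v / δ) ^ p * δ ^ p = v ^ p := by
    rw [← Real.mul_rpow (div_pos hv hδ).le hδ.le, div_mul_cancel₀ _ hδ.ne']
  have e1 : δ ^ (p - 1) = δ ^ p / δ := Real.rpow_sub_one hδ.ne' p
  unfold flightPotential
  rw [← e, e1]
  field_simp
  ring

theorem flightPotential_ne_zero (hp : 2 < p) {δ a δ' v : ℝ} (hδ : 0 < δ)
    (hδ' : δ' ∈ nextDeltaSet p δ a) (hv : 0 < v) (hvδ : v < δ) (hne : v ≠ δ') :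
    flightPotential p δ a v ≠ 0 := by
  rw [flightPotential_eq hδ hv]
  intro h0
  rcases mul_eq_zero.1 h0 with h | h
  · exact (Real.rpow_pos_of_pos hδ p).ne' h
  · exact hne (nextDelta_unique hp hδ ⟨hv, hvδ, h⟩ hδ')

theorem flightPotential_pos (hp : 2 < p) {δ a δ' v : ℝ} (hδ : 0 < δ)
    (hδ' : δ' ∈ nextDeltaSet p δ a) (hv : 0 < v) (hvδ : v < δ') :
    0 < flightPotential p δ a v := by
  obtain ⟨h0, h1, hx⟩ := hδ'
  rw [flightPotential_eq hδ hv]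
  refine mul_pos (Real.rpow_pos_of_pos hδ p) ?_
  have hx0 := div_pos h0 hδ
  have hx1 := (div_lt_one hδ).2 h1
  have hlt := bubble_root_rpow_lt (by linarith) hx0 hx1 hx
  have hy0 := div_pos hv hδ
  have hyx : v / δ < δ' / δ := by gcongr
  set x := δ' / δ
  set y := v / δ
  -- Bernoulli's inequality for the tangent at `x`
  have hb := one_add_mul_self_le_rpow_one_add (s := y / x - 1)
    (by linarith [div_pos hy0 hx0]) (show 1 ≤ p by linarith)
  rw [add_sub_cancel, Real.div_rpow hy0.le hx0.le, le_div_iff₀ (Real.rpow_pos_of_pos hx0 p)] at hb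
  have e : (1 + p * (y / x - 1)) * x ^ p = x ^ p + p * x ^ (p - 1) * (y - x) := by
    rw [Real.rpow_sub_one hx0.ne']
    field_simp
  rw [e] at hb
  have := mul_pos (sub_pos.2 hlt) (sub_pos.2 hyx)
  linarith

/-- The slope `Z` at the end of a flight and its duration (in units of `N`), when `Z` and `V` at
its start and the variation of `Z` are known up to `ε`. -/
theorem flight_duration {a D z z₁ T v w δ ε : ℝ} (hp : 0 < p) (ha0 : 0 < a) (hD : 0 < D)
    (hD1 : D ≤ 1) (hε : 0 ≤ ε) (hT0 : 0 < T) (hTp : T ≤ p) (hz : |D * z - (2 + a)| ≤ ε)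
    (hzz : z ≤ z₁) (hz₁ : z₁ ≤ z + ε) (hv : |v - δ| ≤ ε) (hlo : z * T ≤ p * (v - w))
    (hhi : p * (v - w) ≤ z₁ * T) :
    |D * z₁ - (2 + a)| ≤ 2 * ε ∧ |2 * T - 2 * p * D / (2 + a) * (δ - w)| ≤ 6 * p * ε := by
  have hz' := abs_le.1 hz
  have hDz₁ : |D * z₁ - (2 + a)| ≤ 2 * ε := by
    have h1 : D * z ≤ D * z₁ := mul_le_mul_of_nonneg_left hzz hD.le
    have h2 := mul_le_mul_of_nonneg_left hz₁ hD.le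
    have h3 := mul_le_of_le_one_left hε hD1
    rw [abs_le]; constructor <;> linarith
  refine ⟨hDz₁, ?_⟩
  have h1 := mul_le_mul_of_nonneg_right hz'.1 hT0.le
  have h2 := mul_le_mul_of_nonneg_right (abs_le.1 hDz₁).2 hT0.le
  have h3 : ε * T ≤ ε * p := mul_le_mul_of_nonneg_left hTp hε
  have h4 : D * z * T ≤ D * p * (v - w) := by
    have := mul_le_mul_of_nonneg_left hlo hD.le
    linarith
  have h5 : D * p * (v - w) ≤ D * z₁ * T := by
    have := mul_le_mul_of_nonneg_left hhi hD.le
    linarith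
  have h6 : |D * p * (v - δ)| ≤ p * ε := by
    rw [abs_mul, abs_of_pos (by positivity)]
    exact mul_le_mul (mul_le_of_le_one_left hp.le hD1) hv (abs_nonneg _) hp.le
  have h6' := abs_le.1 h6
  have h7 : |(2 + a) * T - D * p * (δ - w)| ≤ 3 * p * ε := by
    rw [abs_le]; constructor <;> linarith
  have e1 : 2 * T - 2 * p * D / (2 + a) * (δ - w)
      = 2 / (2 + a) * ((2 + a) * T - D * p * (δ - w)) := by field_simp
  rw [e1, abs_mul, abs_of_pos (by positivity)]
  have h8 : 2 / (2 + a) ≤ 2 := by rw [div_le_iff₀ (by linarith)]; linarith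
  have := mul_le_mul h8 h7 (abs_nonneg _) (by norm_num)
  linarith

/-- A quiet point on the lower side of a bubble is followed by one on the upper side of the next
bubble. -/
theorem HasQuietPoints.flight (hp : 2 < p) (hN : Tendsto N atTop atTop)
    (hS : ∀ ρ > 0, ∀ᶠ n in atTop, FastSlow p (N n) ρ (V n) (Z n) (φ n))
    {δ a δ' : ℝ} (hδ : 0 < δ) (hδ1 : δ ≤ 1) (ha0 : 0 < a) (hδ' : δ' ∈ nextDeltaSet p δ a)
    (h : HasQuietPoints p N V Z φ δ (2 + a)) :
    HasQuietPoints p N V Z φ δ' ((δ' / δ) ^ (p - 1) * (2 + a)) := by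
  obtain ⟨hδ'0, hδ'δ, -⟩ := id hδ'
  have hD := Real.rpow_pos_of_pos hδ (p - 1)
  have hD1 : δ ^ (p - 1) ≤ 1 := Real.rpow_le_one hδ.le hδ1 (by linarith)
  have hcont : ∀ v, 0 < v → ContinuousAt (flightPotential p δ a) v := fun v hv => by
    have := Real.continuousAt_rpow_const v p (Or.inl hv.ne')
    unfold flightPotential
    fun_prop
  suffices H : ∀ ε > 0, ε ≤ δ' / 2 → ∀ᶠ n in atTop, ∃ x < 0, |V n x - δ'| < ε ∧
      |δ' ^ (p - 1) * Z n x - (δ' / δ) ^ (p - 1) * (2 + a)| < ε ∧ φ n x = 1 / N n ^ 2 by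
    intro ε hε
    refine (H (min ε (δ' / 2)) (by positivity) (min_le_right _ _)).mono ?_
    rintro n ⟨x, hx, h1, h2, h3⟩
    exact ⟨x, hx, h1.trans_le (min_le_left _ _), h2.trans_le (min_le_left _ _), h3⟩
  intro ε hε hεδ
  set D := δ ^ (p - 1) with hDdef
  obtain ⟨v₂, hv₂, hδv₂, hrate⟩ : ∃ v₂ < δ, δ' < v₂ ∧ 2 * D < v₂ ^ (p - 1) * (2 + a) := by
    have hc := (Real.continuousAt_rpow_const δ (p - 1) (Or.inl hδ.ne')).mul_const (2 + a)
    have h1 : ∀ᶠ v in 𝓝[<] δ, 2 * D < v ^ (p - 1) * (2 + a) :=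
      (hc.tendsto.mono_left nhdsWithin_le_nhds).eventually_const_lt
        (by rw [← hDdef]; nlinarith)
    obtain ⟨v, h2, h3⟩ := (h1.and (Ioo_mem_nhdsLT hδ'δ)).exists
    exact ⟨v, h3.2, h3.1, h2⟩
  -- away from `δ'` the flight potential is bounded away from zero
  obtain ⟨c₁, hc₁, hK⟩ : ∃ c₁ > 0, ∀ v ∈ Icc (δ' / 2) v₂ ∩ {v | ε ≤ |v - δ'|},
      c₁ ≤ |flightPotential p δ a v| := by
    refine IsCompact.exists_forall_le' (f := fun v => |flightPotential p δ a v|)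
      (isCompact_Icc.inter_right (isClosed_le continuous_const (by fun_prop))) ?_ ?_
    · intro v hv
      exact (hcont v (by linarith [hv.1.1])).abs.continuousWithinAt
    · intro v hv
      refine abs_pos.2 (flightPotential_ne_zero hp hδ hδ' (by linarith [hv.1.1])
        (hv.1.2.trans_lt hv₂) fun heq => ?_)
      have := hv.2
      rw [mem_ofPred_eq, heq, sub_self, abs_zero] at this
      linarith
  obtain ⟨ε₁, hε₁, hrate₁, hε1, hεc, hεD⟩ : ∃ ε₁ > 0,
      2 * D < v₂ ^ (p - 1) * (2 + a - ε₁) * (1 - ε₁) ∧ ε₁ ≤ 1 ∧ (6 * p + 2) * ε₁ < c₁ ∧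
      2 * ε₁ < ε * D := by
    have t0 : ∀ᶠ x : ℝ in 𝓝[>] 0, 2 * D < v₂ ^ (p - 1) * (2 + a - x) * (1 - x) := by
      have : ContinuousAt (fun x : ℝ => v₂ ^ (p - 1) * (2 + a - x) * (1 - x)) 0 := by fun_prop
      exact (this.tendsto.mono_left nhdsWithin_le_nhds).eventually_const_lt (by simpa using hrate)
    have t1 : ∀ᶠ x : ℝ in 𝓝[>] 0, x ∈ Ioo (0 : ℝ) (min 1 (min (c₁ / (6 * p + 2)) (ε * D / 2))) :=
      Ioo_mem_nhdsGT (by positivity)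
    obtain ⟨x, h0, hx0, hx1⟩ := (t0.and t1).exists
    have h1 := hx1.trans_le (min_le_left _ _)
    have h2 := hx1.trans_le ((min_le_right _ _).trans (min_le_left _ _))
    have h3 := hx1.trans_le ((min_le_right _ _).trans (min_le_right _ _))
    rw [lt_div_iff₀ (by linarith)] at h2
    exact ⟨x, hx0, h0, h1.le, by linarith, by linarith⟩
  obtain ⟨r, hr0, -, hr⟩ := exists_rpow_near (q := p) hδ hε₁
  set v₃ := δ' / 2 with hv₃
  have hv₃0 : 0 < v₃ := by positivity
  have hv₃p := Real.rpow_pos_of_pos hv₃0 (p - 1)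
  -- the last entry places the starting point of the flight above `v₂`
  set η := min (min r ε₁) (δ - v₂) with hη
  have hη0 : 0 < η := lt_min (lt_min hr0 hε₁) (by linarith)
  filter_upwards [hS (min ε₁ v₃) (lt_min hε₁ hv₃0), hN.eventually_gt_atTop 0, h η hη0,
    hN.eventually_ge_atTop (p / (v₃ ^ (p - 1) * ε₁))] with n S hN0 hτ hNbig
  obtain ⟨τ, hτ0, hVτ, hZτ, hφτ⟩ := hτ
  have hVr := hVτ.le.trans ((min_le_left _ _).trans (min_le_left _ _))
  have hVε := abs_le.1 (hVτ.le.trans ((min_le_left _ _).trans (min_le_right _ _)))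
  have hV2 := (abs_lt.1 (hVτ.trans_le (min_le_right _ _))).1
  have hZε := abs_le.1 (hZτ.le.trans ((min_le_left _ _).trans (min_le_right _ _)))
  have hθ0 : 0 < 1 / N n ^ 2 := by positivity
  have hρ : min ε₁ v₃ ≤ ε₁ := min_le_left _ _
  have hv₂p := Real.rpow_pos_of_pos (hδ'0.trans hδv₂) (p - 1)
  obtain ⟨e, hτe, he0, hVe₃, hVe₂, hφe, hor, hZe, hlog⟩ := S.exists_flight_end hτ0 hv₃0
    (min_le_right _ _) (by linarith) (by linarith : v₂ < V n τ) hφτ (hρ.trans hε1) (by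
      have h1 : v₂ ^ (p - 1) * (2 + a - ε₁) * (1 - ε₁)
          ≤ v₂ ^ (p - 1) * (D * Z n τ) * (1 - min ε₁ v₃) := by
        have := S.Z_nonneg τ hτ0
        apply mul_le_mul _ (by linarith) (by linarith) (by positivity)
        exact mul_le_mul_of_nonneg_left (by linarith) hv₂p.le
      have h2 : D * 2 < D * (v₂ ^ (p - 1) * Z n τ * (1 - min ε₁ v₃)) := by linarith
      exact lt_of_mul_lt_mul_left h2 hD.le)
  have hφe0 := S.phi_pos e he0 ((min_le_right _ _).trans hVe₃)
  set z := Z n τ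
  set z₁ := Z n e
  set v := V n τ
  set w := V n e
  have hzz : z ≤ z₁ := S.Z_le hτe.le he0
  have hz1 : 1 ≤ D * z := by linarith
  have hz1' : 1 ≤ z := hz1.trans (mul_le_of_le_one_left (S.Z_nonneg τ hτ0) hD1)
  set T := (e - τ) / N n with hT
  have hTe : e - τ = N n * T := by rw [hT]; field_simp
  have hT0 : 0 < T := div_pos (by linarith) hN0
  have hv1 : v ≤ 1 := S.V_le_one τ hτ0
  have hTlo : z * T ≤ p * (v - w) := by
    have := S.mul_Z_le hτe.le he0.le
    rw [hTe] at this
    have : N n * (z * T) ≤ N n * (p * (v - w)) := by linarith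
    exact le_of_mul_le_mul_left this hN0
  have hThi : p * (v - w) ≤ z₁ * T := by
    have := S.le_mul_Z hτe.le he0 le_rfl
    rw [hTe] at this
    have : N n * (p * (v - w)) ≤ N n * (z₁ * T) := by linarith
    exact le_of_mul_le_mul_left this hN0
  have hw0 : 0 < w := S.V_pos e he0
  have hTp : T ≤ p := by
    have h1 := mul_le_mul_of_nonneg_right hz1' hT0.le
    have h2 := mul_le_of_le_one_right (show 0 ≤ p by linarith) (show v - w ≤ 1 by linarith)
    linarith
  have hz₁z : z₁ ≤ z + ε₁ := by
    refine hZe.trans (add_le_add le_rfl ?_)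
    rw [hTe]
    have e1 : 1 / N n ^ 2 / v₃ ^ (p - 1) * (N n * T) = T / (v₃ ^ (p - 1) * N n) := by
      field_simp
    rw [e1, div_le_iff₀ (by positivity)]
    rw [div_le_iff₀ (by positivity)] at hNbig
    linarith
  obtain ⟨hDz₁, hTT⟩ := flight_duration (by linarith) ha0 hD hD1 hε₁.le hT0 hTp (abs_le.2 hZε) hzz
    hz₁z (abs_le.2 hVε) hTlo hThi
  have hG : |(Real.log (φ n e) - Real.log (1 / N n ^ 2)) / N n - flightPotential p δ a w|
      ≤ (6 * p + 2) * ε₁ := by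
    set L := (Real.log (φ n e) - Real.log (1 / N n ^ 2)) / N n with hL
    have hLe : Real.log (φ n e) - Real.log (1 / N n ^ 2) = N n * L := by rw [hL]; field_simp
    rw [hLe, hTe, show N n * L - 2 * (N n * T) - N n * (w ^ p - v ^ p)
      = N n * (L - 2 * T - (w ^ p - v ^ p)) by ring, abs_mul, abs_of_pos hN0, mul_comm _ (N n)]
      at hlog
    have h1 := (le_of_mul_le_mul_left hlog hN0).trans hρ
    have h2 := abs_le.1 (hr v hVr)
    have h1' := abs_le.1 h1
    have h3 := abs_le.1 hTT
    unfold flightPotential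
    rw [abs_le]
    constructor <;> linarith
  have hGlt := abs_lt.1 (hG.trans_lt hεc)
  -- at height `v₃` below `δ'` the potential is positive, so `φ` would already be above its level
  have hφθ : φ n e = 1 / N n ^ 2 := by
    refine hor.resolve_right fun hwv => ?_
    have hpos := flightPotential_pos hp hδ hδ' hv₃0 (by linarith : v₃ < δ')
    have := hK v₃ ⟨⟨le_rfl, by linarith⟩, by
      rw [mem_ofPred_eq, abs_sub_comm, abs_of_pos (by linarith)]; linarith⟩
    rw [abs_of_pos hpos, ← hwv] at this
    have hle : (Real.log (φ n e) - Real.log (1 / N n ^ 2)) / N n ≤ 0 :=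
      div_nonpos_of_nonpos_of_nonneg (by linarith [Real.log_le_log hφe0 hφe]) hN0.le
    linarith [hGlt.1]
  refine ⟨e, he0, ?_, ?_, hφθ⟩
  · by_contra hge
    have := hK w ⟨⟨hVe₃, hVe₂⟩, not_lt.1 hge⟩
    rw [hφθ, sub_self, zero_div, zero_sub, abs_neg] at hG
    linarith
  · rw [Real.div_rpow hδ'0.le hδ.le, ← hDdef]
    have hδ'p := Real.rpow_pos_of_pos hδ'0 (p - 1)
    have hlt : δ' ^ (p - 1) ≤ 1 := Real.rpow_le_one hδ'0.le (by linarith) (by linarith)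
    have e1 : δ' ^ (p - 1) * z₁ - δ' ^ (p - 1) / D * (2 + a)
        = δ' ^ (p - 1) * (D * z₁ - (2 + a)) / D := by field_simp
    rw [e1, abs_div, abs_mul, abs_of_pos hD, abs_of_pos hδ'p, div_lt_iff₀ hD]
    have := mul_le_mul hlt hDz₁ (abs_nonneg _) zero_le_one
    linarith

theorem hasCentres_bubble (hp : 2 < p) (hN : Tendsto N atTop atTop)
    (hS : ∀ ρ > 0, ∀ᶠ n in atTop, FastSlow p (N n) ρ (V n) (Z n) (φ n)) (k : ℕ) :
    HasCentres p V Z φ (bubbleDelta p k) (bubbleA p k) := by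
  have key : ∀ k, HasQuietPoints p N V Z φ (bubbleDelta p k) (2 - bubbleA p k) := by
    intro k
    induction k with
    | zero =>
      have := hasQuietPoints_one (by linarith) hN hS
      simpa [bubbleDelta, bubbleA, bubblePair] using this
    | succ k ih =>
      obtain ⟨hδ, ha0, ha2⟩ := bubblePair_bounds hp k
      obtain ⟨-, -, ⟨h0, h1⟩, -, h2, h3⟩ := bubble_recurrence hp k
      have := (ih.bubble hN hS hδ ha0 ha2 (by linarith)).2.flight hp hN hS hδ
        (bubbleDelta_le_one hp k) ha0 ⟨h0, h1, h2⟩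
      rwa [show (bubbleDelta p (k + 1) / bubbleDelta p k) ^ (p - 1) * (2 + bubbleA p k)
        = 2 - bubbleA p (k + 1) by rw [h3]; ring] at this
  obtain ⟨hδ, ha0, ha2⟩ := bubblePair_bounds hp k
  exact ((key k).bubble hN hS hδ ha0 ha2 (by linarith)).1

end

/-! ### Radial solutions as slow-fast systems -/

theorem StandingCond.hasDerivAt {h : ℝ → ℝ} (hh : StandingCond h) {t : ℝ} (ht : 0 < t) :
    HasDerivAt h (deriv h t) t :=
  ((hh.contDiffOn.contDiffAt (Ici_mem_nhds ht)).differentiableAt (by norm_num)).hasDerivAt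

theorem nonlin_nonneg {p : ℝ} {h : ℝ → ℝ} (hh : StandingCond h) {t : ℝ} (ht : 0 ≤ t) :
    0 ≤ nonlin p h t :=
  mul_nonneg (hh.nonneg t ht) (Real.exp_pos _).le

theorem continuousOn_nonlin {p : ℝ} (hp : 0 ≤ p) {h : ℝ → ℝ} (hh : StandingCond h) :
    ContinuousOn (nonlin p h) (Ici 0) := by
  have := Real.continuous_rpow_const (q := p) hp
  exact hh.contDiffOn.continuousOn.mul (Real.continuous_exp.comp this).continuousOn

/-- The relative error made by keeping only `e ^ (t ^ p)` when `t ^ (p - 1) h(t) e ^ (t ^ p)` is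
differentiated. -/
noncomputable def growthError (p : ℝ) (h : ℝ → ℝ) (t : ℝ) : ℝ :=
  ((p - 1) / t + deriv h t / h t) / (p * t ^ (p - 1))

theorem tendsto_growthError {p : ℝ} (hp : 1 < p) {h : ℝ → ℝ} (hg : GrowthCond p h) :
    Tendsto (growthError p h) atTop (𝓝 0) := by
  have h1 : Tendsto (fun t : ℝ => (p - 1) / p * (t ^ p)⁻¹) atTop (𝓝 ((p - 1) / p * 0)) :=
    (tendsto_rpow_atTop (by linarith)).inv_tendsto_atTop.const_mul _
  have h2 := (hg.const_mul (1 / p)).add h1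
  simp only [mul_zero, add_zero] at h2
  refine h2.congr' ?_
  filter_upwards [eventually_gt_atTop 0] with t ht
  have hp0 : p ≠ 0 := by linarith
  have e : t ^ p = t ^ (p - 1) * t := by rw [← Real.rpow_add_one ht.ne']; ring_nf
  rw [growthError, e]
  rcases eq_or_ne (h t) 0 with h0 | h0
  · simp only [h0]; field_simp; ring
  · have := (Real.rpow_pos_of_pos ht (p - 1)).ne'
    field_simp
    ring

namespace IsRadialSolution

variable {p : ℝ} {h : ℝ → ℝ} {lam mu : ℝ} {u : ℝ → ℝ}

theorem hasDerivAt (S : IsRadialSolution p h lam mu u) {r : ℝ} (hr : r ∈ Ioo (0 : ℝ) 1) :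
    HasDerivAt u (deriv u r) r :=
  ((S.contDiffOn.contDiffAt (isOpen_Ioo.mem_nhds hr)).differentiableAt (by norm_num)).hasDerivAt

theorem hasDerivAt_mul_deriv (S : IsRadialSolution p h lam mu u) {r : ℝ} (hr : r ∈ Ioo (0 : ℝ) 1) :
    HasDerivAt (fun r => r * deriv u r) (-(lam * nonlin p h (u r) * r)) r := by
  have h1 : ContDiffOn ℝ 1 (deriv u) (Ioo 0 1) :=
    S.contDiffOn.deriv_of_isOpen isOpen_Ioo (by norm_num)
  have h2 : HasDerivAt (deriv u) (deriv (deriv u) r) r :=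
    ((h1.contDiffAt (isOpen_Ioo.mem_nhds hr)).differentiableAt (by norm_num)).hasDerivAt
  refine ((hasDerivAt_id r).fun_mul h2).congr_deriv ?_
  have := S.equation r hr
  have hr0 := hr.1.ne'
  rw [← this]
  simp only [id]
  field_simp
  ring

theorem nonneg (S : IsRadialSolution p h lam mu u) {r : ℝ} (hr : r ∈ Icc (0 : ℝ) 1) : 0 ≤ u r := by
  have h1 : closure (Ioo (0 : ℝ) 1) = Icc 0 1 := closure_Ioo zero_ne_one
  refine ContinuousWithinAt.closure_le (h1 ▸ hr) continuousWithinAt_const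
    ((S.continuousOn r hr).mono Ioo_subset_Icc_self) fun y hy => (S.pos y hy).le

theorem antitoneOn_mul_deriv (hh : StandingCond h) (S : IsRadialSolution p h lam mu u) :
    AntitoneOn (fun r => r * deriv u r) (Ioo 0 1) := by
  apply antitoneOn_of_deriv_nonpos (convex_Ioo 0 1)
  · exact fun x hx => (S.hasDerivAt_mul_deriv hx).continuousAt.continuousWithinAt
  · rw [interior_Ioo]
    exact fun x hx => (S.hasDerivAt_mul_deriv hx).differentiableAt.differentiableWithinAt
  · rw [interior_Ioo]
    intro x hx
    rw [(S.hasDerivAt_mul_deriv hx).deriv]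
    have := mul_nonneg (mul_nonneg S.lam_pos.le (nonlin_nonneg (p := p) hh (S.pos x hx).le)) hx.1.le
    linarith

theorem tendsto_mul_deriv (hh : StandingCond h) (S : IsRadialSolution p h lam mu u) :
    Tendsto (fun r => r * deriv u r) (𝓝[>] 0) (𝓝 0) := by
  have hd := S.deriv_zero.hasFDerivWithinAt.isLittleO.bound (show (0 : ℝ) < 1 by norm_num)
  obtain ⟨d, hd0, hd⟩ := Metric.mem_nhdsWithin_iff.1 hd
  have hu : ∀ r, 0 < r → r < d → r ≤ 1 → |u r - u 0| ≤ r := by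
    intro r h0 h1 h2
    have := hd ⟨by rw [mem_ball_zero_iff, Real.norm_of_nonneg h0.le]; exact h1, h0.le, h2⟩
    simpa [abs_of_pos h0] using this
  -- by the mean value theorem `u'` is small at some points, and `r u'` is monotone
  have hmv : ∀ r, 0 < r → 2 * r < d → 2 * r < 1 → ∃ s ∈ Ioo r (2 * r),
      |s * deriv u s| ≤ 6 * r := by
    intro r h0 h1 h2
    obtain ⟨s, hs, he⟩ := exists_deriv_eq_slope u (show r < 2 * r by linarith)
      (S.continuousOn.mono fun t ht => ⟨h0.le.trans ht.1, ht.2.trans h2.le⟩)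
      fun t ht => (S.hasDerivAt ⟨h0.trans ht.1, ht.2.trans h2⟩).differentiableAt.differentiableWithinAt
    refine ⟨s, hs, ?_⟩
    have a1 := abs_le.1 (hu r h0 (by linarith) (by linarith))
    have a2 := abs_le.1 (hu (2 * r) (by linarith) h1 h2.le)
    have hs0 : 0 < s := h0.trans hs.1
    have a3 : |deriv u s| ≤ 3 := by
      rw [he, abs_div, abs_of_pos (show 0 < 2 * r - r by linarith), div_le_iff₀ (by linarith), abs_le]
      constructor <;> linarith
    rw [abs_mul, abs_of_pos hs0]
    have := mul_le_mul hs.2.le a3 (abs_nonneg _) (by linarith)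
    linarith
  have hmono := S.antitoneOn_mul_deriv hh
  have hb : ∀ᶠ r in 𝓝[>] (0 : ℝ), |r * deriv u r| ≤ 6 * r := by
    filter_upwards [Ioo_mem_nhdsGT (show (0 : ℝ) < min (d / 2) (1 / 2) by positivity)] with r hr
    have hr1 := hr.2.trans_le (min_le_left _ _)
    have hr2 := hr.2.trans_le (min_le_right _ _)
    obtain ⟨s, hs, hsb⟩ := hmv r hr.1 (by linarith) (by linarith)
    obtain ⟨t, ht, htb⟩ := hmv (r / 2) (by linarith [hr.1]) (by linarith [hr.1]) (by linarith [hr.1])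
    have hr0 := hr.1
    have m1 := hmono (a := r) ⟨hr0, by linarith⟩ ⟨hr0.trans hs.1, by linarith [hs.2]⟩ hs.1.le
    have m2 := hmono (a := t) (b := r) ⟨by linarith [ht.1], by linarith [ht.2]⟩ ⟨hr0, by linarith⟩
      (by linarith [ht.2])
    simp only at m1 m2
    have := abs_le.1 hsb
    have := abs_le.1 htb
    rw [abs_le]
    constructor <;> linarith
  have hz : Tendsto (fun r : ℝ => 6 * r) (𝓝[>] 0) (𝓝 0) := by
    have : Tendsto (fun r : ℝ => 6 * r) (𝓝 0) (𝓝 (6 * 0)) := by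
      exact (continuous_const.mul continuous_id).tendsto 0
    rw [mul_zero] at this
    exact this.mono_left nhdsWithin_le_nhds
  exact squeeze_zero_norm' (by simpa using hb) hz

theorem mul_deriv_nonpos (hh : StandingCond h) (S : IsRadialSolution p h lam mu u) {r : ℝ}
    (hr : r ∈ Ioo (0 : ℝ) 1) : r * deriv u r ≤ 0 := by
  refine ge_of_tendsto (S.tendsto_mul_deriv hh) ?_
  filter_upwards [Ioo_mem_nhdsGT hr.1] with t ht
  exact S.antitoneOn_mul_deriv hh ⟨ht.1, ht.2.trans hr.2⟩ hr ht.2.le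

theorem antitoneOn (hh : StandingCond h) (S : IsRadialSolution p h lam mu u) :
    AntitoneOn u (Icc 0 1) := by
  apply antitoneOn_of_deriv_nonpos (convex_Icc 0 1) S.continuousOn
  · rw [interior_Icc]
    exact fun x hx => (S.hasDerivAt hx).differentiableAt.differentiableWithinAt
  · rw [interior_Icc]
    intro x hx
    have := S.mul_deriv_nonpos hh hx
    by_contra hlt
    linarith [mul_pos hx.1 (not_le.1 hlt)]

theorem le_apply_zero (hh : StandingCond h) (S : IsRadialSolution p h lam mu u) {r : ℝ}
    (hr : r ∈ Icc (0 : ℝ) 1) : u r ≤ mu :=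
  S.apply_zero ▸ S.antitoneOn hh ⟨le_rfl, zero_le_one⟩ hr hr.1

theorem exp_mem {x : ℝ} (hx : x < 0) : Real.exp x ∈ Ioo (0 : ℝ) 1 :=
  ⟨Real.exp_pos x, Real.exp_lt_one_iff.2 hx⟩

theorem hasDerivAt_comp_exp (S : IsRadialSolution p h lam mu u) {x : ℝ} (hx : x < 0) :
    HasDerivAt (fun x => u (Real.exp x)) (Real.exp x * deriv u (Real.exp x)) x := by
  refine ((S.hasDerivAt (exp_mem hx)).comp x (Real.hasDerivAt_exp x)).congr_deriv ?_
  ring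

theorem hasDerivAt_mul_deriv_comp_exp (S : IsRadialSolution p h lam mu u) {x : ℝ} (hx : x < 0) :
    HasDerivAt (fun x => Real.exp x * deriv u (Real.exp x))
      (-(lam * Real.exp x ^ 2 * nonlin p h (u (Real.exp x)))) x := by
  refine ((S.hasDerivAt_mul_deriv (exp_mem hx)).comp x (Real.hasDerivAt_exp x)).congr_deriv ?_
  ring

theorem hasDerivAt_bubblePhi_comp_exp (hp : 1 < p) (hh : StandingCond h)
    (S : IsRadialSolution p h lam mu u) {x : ℝ} (hx : x < 0) (hpos : 0 < h (u (Real.exp x))) :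
    HasDerivAt (fun x => bubblePhi p h lam u (Real.exp x))
      (bubblePhi p h lam u (Real.exp x) * (2 + p * u (Real.exp x) ^ (p - 1) *
        (Real.exp x * deriv u (Real.exp x)) * (1 + growthError p h (u (Real.exp x))))) x := by
  have hu0 := S.pos _ (exp_mem hx)
  have hw := S.hasDerivAt_comp_exp hx
  have h1 := ((Real.hasDerivAt_exp x).fun_pow 2).const_mul (p * lam)
  have h2 := hw.rpow_const (p := p - 1) (Or.inl hu0.ne')
  have h3 := (hh.hasDerivAt hu0).comp x hw
  have h4 := (hw.rpow_const (p := p) (Or.inl hu0.ne')).exp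
  refine ((h1.fun_mul h2).fun_mul (h3.fun_mul h4)).congr_deriv ?_
  have e2 : u (Real.exp x) ^ (p - 1 - 1) = u (Real.exp x) ^ (p - 1) / u (Real.exp x) :=
    Real.rpow_sub_one hu0.ne' _
  have hup := (Real.rpow_pos_of_pos hu0 (p - 1)).ne'
  have hp0 : p ≠ 0 := by linarith
  rw [e2]
  unfold bubblePhi nonlin growthError
  simp only [Function.comp]
  generalize u (Real.exp x) = w at *
  have hw0 := hu0.ne'
  have hh0 := hpos.ne'
  field_simp
  push_cast
  ring

/-- A solution with a large maximum is a slow-fast system in the variable `log r`. -/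
theorem fastSlow (hp : 1 < p) (hh : StandingCond h) (S : IsRadialSolution p h lam mu u)
    (hmu : 0 < mu) {ρ T : ℝ} (hTmu : T ≤ ρ * mu)
    (hT : ∀ t, T ≤ t → 0 < h t ∧ |growthError p h t| ≤ ρ) :
    FastSlow p (mu ^ p) ρ (fun x => u (Real.exp x) / mu)
      (fun x => -(p * mu ^ (p - 1) * (Real.exp x * deriv u (Real.exp x))))
      (fun x => bubblePhi p h lam u (Real.exp x)) := by
  have hp0 : 0 < p := by linarith
  have hmp := Real.rpow_pos_of_pos hmu (p - 1)
  have hexp : Tendsto Real.exp atBot (𝓝[>] 0) := Real.tendsto_exp_atBot_nhdsGT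
  have hTu : ∀ x, ρ ≤ u (Real.exp x) / mu → T ≤ u (Real.exp x) := fun x hx =>
    hTmu.trans ((le_div_iff₀ hmu).1 hx)
  have hphi : ∀ x < 0, 0 ≤ bubblePhi p h lam u (Real.exp x) := fun x hx => by
    have h1 := S.pos _ (exp_mem hx)
    have h2 := nonlin_nonneg (p := p) hh h1.le
    have h3 := S.lam_pos
    unfold bubblePhi
    positivity
  have hcu : Tendsto u (𝓝[>] 0) (𝓝 mu) := by
    have := S.continuousOn 0 ⟨le_rfl, zero_le_one⟩
    rw [ContinuousWithinAt, S.apply_zero] at this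
    refine this.mono_left ?_
    rw [← nhdsWithin_Ioo_eq_nhdsGT (zero_lt_one' ℝ)]
    exact nhdsWithin_mono _ Ioo_subset_Icc_self
  have hV : ∀ x, (u (Real.exp x) / mu) ^ (p - 1) = u (Real.exp x) ^ (p - 1) / mu ^ (p - 1) ∨ 0 ≤ x :=
    fun x => (lt_or_ge x 0).imp (fun hx => Real.div_rpow (S.pos _ (exp_mem hx)).le hmu.le _) id
  refine ⟨hp, Real.rpow_pos_of_pos hmu p, ?_, by simp [S.apply_one], ?_, ?_, ?_, hphi, ?_, ?_, ?_, ?_,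
    ?_, ?_, ?_⟩
  · refine (S.continuousOn.comp Real.continuous_exp.continuousOn fun x hx => ?_).div_const mu
    exact ⟨(Real.exp_pos x).le, Real.exp_le_one_iff.2 hx⟩
  · exact fun x hx => div_pos (S.pos _ (exp_mem hx)) hmu
  · exact fun x hx => (div_le_one hmu).2 (S.le_apply_zero hh (Ioo_subset_Icc_self (exp_mem hx)))
  · intro x hx
    have := mul_nonneg (mul_pos hp0 hmp).le (neg_nonneg.2 (S.mul_deriv_nonpos hh (exp_mem hx)))
    linarith
  · intro x hx hρ
    have h1 := S.pos _ (exp_mem hx)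
    have h2 := (hT _ (hTu x hρ)).1
    have h3 := S.lam_pos
    unfold bubblePhi nonlin
    positivity
  · intro x hx
    refine ((S.hasDerivAt_comp_exp hx).div_const mu).congr_deriv ?_
    rw [Real.rpow_sub_one hmu.ne']
    have := (Real.rpow_pos_of_pos hmu p).ne'
    field_simp
  · intro x hx
    refine (((S.hasDerivAt_mul_deriv_comp_exp hx).const_mul (p * mu ^ (p - 1))).fun_neg).congr_deriv ?_
    have hu0 := S.pos _ (exp_mem hx)
    rw [(hV x).resolve_right (not_le.2 hx)]
    have := (Real.rpow_pos_of_pos hu0 (p - 1)).ne'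
    unfold bubblePhi
    field_simp
  · intro x hx hρ
    obtain ⟨h1, h2⟩ := hT _ (hTu x hρ)
    refine ⟨_, h2, (S.hasDerivAt_bubblePhi_comp_exp hp hh hx h1).congr_deriv ?_⟩
    rw [(hV x).resolve_right (not_le.2 hx)]
    field_simp
    ring
  · have := (hcu.comp hexp).div_const mu
    rwa [div_self hmu.ne'] at this
  · have := (((S.tendsto_mul_deriv hh).comp hexp).const_mul (p * mu ^ (p - 1))).neg
    rwa [mul_zero, neg_zero] at this
  · have h1 : Tendsto (fun r => bubblePhi p h lam u r) (𝓝[>] 0)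
        (𝓝 (p * lam * 0 ^ 2 * mu ^ (p - 1) * nonlin p h mu)) := by
      have h2 : Tendsto (fun r : ℝ => p * lam * r ^ 2) (𝓝[>] 0) (𝓝 (p * lam * 0 ^ 2)) := by
        have : Continuous fun r : ℝ => p * lam * r ^ 2 := by fun_prop
        exact (this.tendsto 0).mono_left nhdsWithin_le_nhds
      have h3 := (Real.continuousAt_rpow_const mu (p - 1) (Or.inl hmu.ne')).tendsto.comp hcu
      have h4 := ((continuousOn_nonlin hp0.le hh).continuousAt (Ici_mem_nhds hmu)).tendsto.comp hcu
      exact (h2.mul h3).mul h4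
    have := h1.comp hexp
    simpa [Function.comp_def] using this

end IsRadialSolution

/-! ### Asymptotics of `log φ` and estimates for the integrals -/

/-- A diagonal argument: approximate minimizers of `d n` form the sequence. -/
theorem exists_seq_tendsto_zero {d : ℕ → ℝ → ℝ} {s : Set ℝ} (hs : s.Nonempty)
    (hd : ∀ n x, 0 ≤ d n x) (h : ∀ ε > 0, ∀ᶠ n in atTop, ∃ x ∈ s, d n x < ε) :
    ∃ x : ℕ → ℝ, (∀ n, x n ∈ s) ∧ Tendsto (fun n => d n (x n)) atTop (𝓝 0) := by
  have hbdd : ∀ n, BddBelow (d n '' s) := fun n => ⟨0, by rintro _ ⟨x, -, rfl⟩; exact hd n x⟩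
  have hex : ∀ n : ℕ, ∃ x ∈ s, d n x < sInf (d n '' s) + 1 / ((n : ℝ) + 1) := by
    intro n
    obtain ⟨_, ⟨x, hx, rfl⟩, hlt⟩ := exists_lt_of_csInf_lt (hs.image (d n))
      (show sInf (d n '' s) < sInf (d n '' s) + 1 / ((n : ℝ) + 1) by
        have : 0 < 1 / ((n : ℝ) + 1) := by positivity
        linarith)
    exact ⟨x, hx, hlt⟩
  choose x hx hlt using hex
  refine ⟨x, hx, ?_⟩
  rw [Metric.tendsto_atTop']
  intro ε hε
  have h1 := (tendsto_one_div_add_atTop_nhds_zero_nat (𝕜 := ℝ)).eventually_lt_const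
    (show 0 < ε / 2 by linarith)
  obtain ⟨m, hm⟩ := eventually_atTop.1 ((h (ε / 2) (by linarith)).and h1)
  refine ⟨m, fun n hn => ?_⟩
  obtain ⟨⟨y, hy, hyε⟩, h2⟩ := hm n hn.le
  have h3 := csInf_le (hbdd n) (mem_image_of_mem (d n) hy)
  rw [Real.dist_eq, sub_zero, abs_of_nonneg (hd _ _)]
  linarith [hlt n]

theorem tendsto_log_div_rpow {p : ℝ} (hp : 1 < p) {h : ℝ → ℝ} (hh : StandingCond h)
    (hg : GrowthCond p h) : Tendsto (fun t => Real.log (h t) / t ^ p) atTop (𝓝 0) := by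
  obtain ⟨t₀, -, hpos⟩ := hh.eventually_pos
  rw [Metric.tendsto_atTop]
  intro ε hε
  have hgε := Metric.tendsto_atTop.1 hg (ε / 2) (by linarith)
  obtain ⟨T₁, hT₁⟩ := hgε
  set T := max 1 (max t₀ T₁)
  have hT1 : 1 ≤ T := le_max_left _ _
  have hTt : t₀ ≤ T := (le_max_left _ _).trans (le_max_right _ _)
  have hTT : T₁ ≤ T := (le_max_right _ _).trans (le_max_right _ _)
  have hder : ∀ t, T ≤ t → ∃ d g : ℝ, |d| ≤ ε / 2 * g ∧
      HasDerivAt (fun t => Real.log (h t)) d t ∧ HasDerivAt (fun t : ℝ => t ^ p) g t := by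
    intro t ht
    have ht0 : 0 < t := by linarith
    have hht := hpos t (hTt.trans ht)
    have htp := Real.rpow_pos_of_pos ht0 (p - 1)
    refine ⟨_, _, ?_, (hh.hasDerivAt ht0).log hht.ne',
      Real.hasDerivAt_rpow_const (Or.inl ht0.ne')⟩
    have := hT₁ t (hTT.trans ht)
    rw [Real.dist_eq, sub_zero, abs_div, abs_of_pos (mul_pos htp hht),
      div_lt_iff₀ (mul_pos htp hht)] at this
    rw [abs_div, abs_of_pos hht, div_le_iff₀ hht]
    have h1 : 1 * t ^ (p - 1) ≤ p * t ^ (p - 1) := mul_le_mul_of_nonneg_right hp.le htp.le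
    have h2 := mul_le_mul_of_nonneg_left h1 (mul_pos (show 0 < ε / 2 by linarith) hht).le
    linarith
  have hbig := (tendsto_rpow_atTop (show 0 < p by linarith)).eventually_gt_atTop
    (2 * |Real.log (h T)| / ε)
  obtain ⟨T₂, hT₂⟩ := eventually_atTop.1 hbig
  refine ⟨max T T₂, fun t ht => ?_⟩
  have hTle : T ≤ t := (le_max_left _ _).trans ht
  have h3 := hT₂ t ((le_max_right _ _).trans ht)
  have ht0 : 0 < t := by linarith
  have htp := Real.rpow_pos_of_pos ht0 p
  have hTp := Real.rpow_pos_of_pos (show 0 < T by linarith) p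
  have up := le_of_hasDerivAt_nonneg (f := fun t => ε / 2 * t ^ p - Real.log (h t)) hTle
    fun s hs => by
      obtain ⟨d, g, h1, h2, h3⟩ := hder s hs.1
      exact ⟨_, by linarith [(abs_le.1 h1).2], (h3.const_mul (ε / 2)).fun_sub h2⟩
  have lo := le_of_hasDerivAt_nonneg (f := fun t => ε / 2 * t ^ p + Real.log (h t)) hTle
    fun s hs => by
      obtain ⟨d, g, h1, h2, h3⟩ := hder s hs.1
      exact ⟨_, by linarith [(abs_le.1 h1).1], (h3.const_mul (ε / 2)).fun_add h2⟩
  rw [div_lt_iff₀ hε] at h3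
  have h4 : 0 < ε / 2 * T ^ p := by positivity
  rw [Real.dist_eq, sub_zero, abs_div, abs_of_pos htp, div_lt_iff₀ htp, abs_lt]
  have := neg_abs_le (Real.log (h T))
  have := le_abs_self (Real.log (h T))
  constructor <;> linarith

/-- The logarithm of `φ` at points where `u` is comparable to `μ` and `φ` has a positive limit. -/
theorem tendsto_log_lam_add {p : ℝ} (hp : 1 < p) {h : ℝ → ℝ} (hh : StandingCond h)
    (hg : GrowthCond p h) {lam mu : ℕ → ℝ} {u : ℕ → ℝ → ℝ} (hlam : ∀ n, 0 < lam n)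
    (hmu : Tendsto mu atTop atTop) {r : ℕ → ℝ} (hr : ∀ n, 0 < r n) {δ A : ℝ} (hδ : 0 < δ)
    (hA : 0 < A) (hu : Tendsto (fun n => u n (r n) / mu n) atTop (𝓝 δ))
    (hφ : Tendsto (fun n => bubblePhi p h (lam n) (u n) (r n)) atTop (𝓝 A)) :
    Tendsto (fun n => (Real.log (lam n) + 2 * Real.log (r n)) / mu n ^ p) atTop (𝓝 (-δ ^ p)) := by
  obtain ⟨t₀, -, hpos⟩ := hh.eventually_pos
  have hp0 : 0 < p := by linarith
  have hmp : Tendsto (fun n => mu n ^ p) atTop atTop := (tendsto_rpow_atTop hp0).comp hmu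
  have hu_top : Tendsto (fun n => u n (r n)) atTop atTop := by
    refine (hu.pos_mul_atTop hδ hmu).congr' ?_
    filter_upwards [hmu.eventually_gt_atTop 0] with n hn
    exact div_mul_cancel₀ _ hn.ne'
  have hup : Tendsto (fun n => (u n (r n) / mu n) ^ p) atTop (𝓝 (δ ^ p)) :=
    hu.rpow_const (Or.inl hδ.ne')
  have hlu : Tendsto (fun n => Real.log (u n (r n)) / u n (r n) ^ p * (u n (r n) / mu n) ^ p) atTop
      (𝓝 (0 * δ ^ p)) :=
    ((isLittleO_log_rpow_atTop hp0).tendsto_div_nhds_zero.comp hu_top).mul hup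
  have hlh : Tendsto (fun n => Real.log (h (u n (r n))) / u n (r n) ^ p * (u n (r n) / mu n) ^ p)
      atTop (𝓝 (0 * δ ^ p)) := ((tendsto_log_div_rpow hp hh hg).comp hu_top).mul hup
  have hlφ : Tendsto (fun n => (Real.log (bubblePhi p h (lam n) (u n) (r n)) - Real.log p) / mu n ^ p)
      atTop (𝓝 0) :=
    (((Real.continuousAt_log hA.ne').tendsto.comp hφ).sub_const (Real.log p)).div_atTop hmp
  have := ((hlφ.sub (hlu.const_mul (p - 1))).sub hlh).sub hup
  simp only [zero_mul, mul_zero, sub_zero, zero_sub] at this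
  refine this.congr' ?_
  filter_upwards [hmu.eventually_gt_atTop 0, hu_top.eventually_gt_atTop 0,
    hu_top.eventually_ge_atTop t₀] with n hm hu0 hut
  have hh0 := hpos _ hut
  have hup0 := Real.rpow_pos_of_pos hu0 p
  have hup1 := Real.rpow_pos_of_pos hu0 (p - 1)
  have hmp0 := Real.rpow_pos_of_pos hm p
  have hl := hlam n
  have hrn := hr n
  have e : Real.log (bubblePhi p h (lam n) (u n) (r n)) = Real.log p + Real.log (lam n)
      + 2 * Real.log (r n) + (p - 1) * Real.log (u n (r n)) + Real.log (h (u n (r n)))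
      + u n (r n) ^ p := by
    have hexp := Real.exp_pos (u n (r n) ^ p)
    unfold bubblePhi nonlin
    rw [Real.log_mul (by positivity) (by positivity), Real.log_mul (by positivity) (by positivity),
      Real.log_mul (by positivity) (by positivity), Real.log_mul (by positivity) (by positivity),
      Real.log_mul (by positivity) (by positivity), Real.log_pow, Real.log_rpow hu0, Real.log_exp]
    push_cast
    ring
  rw [e, Real.div_rpow hu0.le hm.le]
  field_simp
  ring

namespace IsRadialSolution

variable {p : ℝ} {h : ℝ → ℝ} {lam mu : ℝ} {u : ℝ → ℝ}

theorem continuousOn_source (hp : 1 < p) (hh : StandingCond h)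
    (S : IsRadialSolution p h lam mu u) :
    ContinuousOn (fun s => lam * nonlin p h (u s) * s) (Icc 0 1) :=
  ((continuousOn_const.mul ((continuousOn_nonlin (by linarith) hh).comp S.continuousOn
    fun _ hx => S.nonneg hx)).mul continuousOn_id)

theorem continuousOn_weighted_source (hp : 1 < p) (hh : StandingCond h)
    (S : IsRadialSolution p h lam mu u) :
    ContinuousOn (fun s => lam * u s ^ (p - 1) * nonlin p h (u s) * s) (Icc 0 1) :=
  ((continuousOn_const.mul (S.continuousOn.rpow_const fun _ _ => Or.inr (by linarith))).mul
    ((continuousOn_nonlin (by linarith) hh).comp S.continuousOn fun _ hx => S.nonneg hx)).mul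
    continuousOn_id

theorem integral_source (hp : 1 < p) (hh : StandingCond h) (S : IsRadialSolution p h lam mu u)
    {a b : ℝ} (ha : 0 < a) (hab : a ≤ b) (hb : b < 1) :
    ∫ s in a..b, lam * nonlin p h (u s) * s = a * deriv u a - b * deriv u b := by
  have := intervalIntegral.integral_eq_sub_of_hasDerivAt
    (f := fun r => -(r * deriv u r)) (f' := fun s => lam * nonlin p h (u s) * s) (a := a) (b := b)
    (fun x hx => by
      rw [uIcc_of_le hab] at hx
      simpa using (S.hasDerivAt_mul_deriv (r := x) ⟨ha.trans_le hx.1, hx.2.trans_lt hb⟩).fun_neg)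
    (((S.continuousOn_source hp hh).mono (by
      rw [uIcc_of_le hab]; exact Icc_subset_Icc ha.le hb.le)).intervalIntegrable)
  rw [this]
  ring

theorem le_integral_weighted_source (hp : 1 < p) (hh : StandingCond h)
    (S : IsRadialSolution p h lam mu u) {a b : ℝ} (ha : 0 < a) (hab : a ≤ b) (hb : b < 1) :
    u b ^ (p - 1) * (a * deriv u a - b * deriv u b)
      ≤ ∫ s in a..b, lam * u s ^ (p - 1) * nonlin p h (u s) * s := by
  have hsub : uIcc a b ⊆ Icc 0 1 := by
    rw [uIcc_of_le hab]; exact Icc_subset_Icc ha.le hb.le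
  rw [← S.integral_source hp hh ha hab hb, ← intervalIntegral.integral_const_mul]
  refine intervalIntegral.integral_mono_on hab
    ((continuousOn_const.mul ((S.continuousOn_source hp hh).mono hsub)).intervalIntegrable)
    (((S.continuousOn_weighted_source hp hh).mono hsub).intervalIntegrable) fun x hx => ?_
  have hx1 : x ∈ Icc (0 : ℝ) 1 := hsub (by rwa [uIcc_of_le hab])
  have hb1 : b ∈ Icc (0 : ℝ) 1 := ⟨ha.le.trans hab, hb.le⟩
  have h1 : u b ^ (p - 1) ≤ u x ^ (p - 1) :=
    Real.rpow_le_rpow (S.nonneg hb1) (S.antitoneOn hh hx1 hb1 hx.2) (by linarith)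
  have h2 := mul_le_mul_of_nonneg_right h1
    (mul_nonneg (mul_nonneg S.lam_pos.le (nonlin_nonneg (p := p) hh (S.nonneg hx1))) hx1.1)
  linarith

theorem integral_weighted_source_mono (hp : 1 < p) (hh : StandingCond h)
    (S : IsRadialSolution p h lam mu u) {a b : ℝ} (ha : 0 ≤ a) (hab : a ≤ b) (hb : b ≤ 1) :
    (∫ s in (0 : ℝ)..a, lam * u s ^ (p - 1) * nonlin p h (u s) * s)
      + (∫ s in a..b, lam * u s ^ (p - 1) * nonlin p h (u s) * s)
      = ∫ s in (0 : ℝ)..b, lam * u s ^ (p - 1) * nonlin p h (u s) * s ∧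
    0 ≤ ∫ s in a..b, lam * u s ^ (p - 1) * nonlin p h (u s) * s := by
  have hc := S.continuousOn_weighted_source hp hh
  refine ⟨intervalIntegral.integral_add_adjacent_intervals
    ((hc.mono ?_).intervalIntegrable) ((hc.mono ?_).intervalIntegrable),
    intervalIntegral.integral_nonneg hab fun x hx => ?_⟩
  · rw [uIcc_of_le ha]; exact Icc_subset_Icc le_rfl (hab.trans hb)
  · rw [uIcc_of_le hab]; exact Icc_subset_Icc ha hb
  · have hx1 : x ∈ Icc (0 : ℝ) 1 := ⟨ha.trans hx.1, hx.2.trans hb⟩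
    exact mul_nonneg (mul_nonneg (mul_nonneg S.lam_pos.le (Real.rpow_nonneg (S.nonneg hx1) _))
      (nonlin_nonneg hh (S.nonneg hx1))) hx1.1

theorem integral_weighted_source_le (hp : 1 < p) (hh : StandingCond h)
    (S : IsRadialSolution p h lam mu u) {b : ℝ} (hb0 : 0 ≤ b) (hb : b ≤ 1) :
    (∫ s in (0 : ℝ)..b, lam * u s ^ (p - 1) * nonlin p h (u s) * s)
      ≤ mu ^ (p - 1) * ∫ s in (0 : ℝ)..b, lam * nonlin p h (u s) * s := by
  have hsub : uIcc 0 b ⊆ Icc 0 1 := by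
    rw [uIcc_of_le hb0]; exact Icc_subset_Icc le_rfl hb
  rw [← intervalIntegral.integral_const_mul]
  refine intervalIntegral.integral_mono_on hb0
    (((S.continuousOn_weighted_source hp hh).mono hsub).intervalIntegrable)
    ((continuousOn_const.mul ((S.continuousOn_source hp hh).mono hsub)).intervalIntegrable)
    fun x hx => ?_
  have hx1 : x ∈ Icc (0 : ℝ) 1 := hsub (by rwa [uIcc_of_le hb0])
  have h1 : u x ^ (p - 1) ≤ mu ^ (p - 1) :=
    Real.rpow_le_rpow (S.nonneg hx1) (S.le_apply_zero hh hx1) (by linarith)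
  have h2 := mul_le_mul_of_nonneg_right h1
    (mul_nonneg (mul_nonneg S.lam_pos.le (nonlin_nonneg (p := p) hh (S.nonneg hx1))) hx1.1)
  linarith

/-- Concavity of `u` as a function of `log (1 / r)`. -/
theorem neg_mul_deriv_mul_log_le (hh : StandingCond h)
    (S : IsRadialSolution p h lam mu u) {r : ℝ} (hr : r ∈ Ioo (0 : ℝ) 1) :
    -(r * deriv u r) * Real.log (1 / r) ≤ u r := by
  have hc : ∀ t ∈ interior (Icc r 1), deriv (fun t => u t - r * deriv u r * Real.log t) t ≤ 0 := by
    intro t ht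
    rw [interior_Icc] at ht
    have ht0 := hr.1.trans ht.1
    have hd := (S.hasDerivAt (r := t) ⟨ht0, ht.2⟩).fun_sub
      ((Real.hasDerivAt_log ht0.ne').const_mul (r * deriv u r))
    rw [hd.deriv]
    have h1 := S.antitoneOn_mul_deriv hh hr ⟨ht0, ht.2⟩ ht.1.le
    simp only at h1
    have h2 : deriv u t - r * deriv u r * t⁻¹ = (t * deriv u t - r * deriv u r) / t := by
      field_simp
    rw [h2]
    exact div_nonpos_of_nonpos_of_nonneg (by linarith) ht0.le
  have := antitoneOn_of_deriv_nonpos (convex_Icc r 1)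
    ((S.continuousOn.mono (Icc_subset_Icc hr.1.le le_rfl)).sub
      (continuousOn_const.mul (Real.continuousOn_log.mono fun t ht =>
        (hr.1.trans_le ht.1).ne')))
    (fun t ht => by
      rw [interior_Icc] at ht
      have ht0 := hr.1.trans ht.1
      exact ((S.hasDerivAt (r := t) ⟨ht0, ht.2⟩).fun_sub
        ((Real.hasDerivAt_log ht0.ne').const_mul
          (r * deriv u r))).differentiableAt.differentiableWithinAt) hc
  have h1 : u 1 - r * deriv u r * Real.log 1 ≤ u r - r * deriv u r * Real.log r :=
    this (left_mem_Icc.2 hr.2.le) (right_mem_Icc.2 hr.2.le) hr.2.le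
  rw [S.apply_one, Real.log_one] at h1
  rw [one_div, Real.log_inv]
  linarith

end IsRadialSolution

/-! ### Consequences for a blowing-up sequence -/

section

variable {p : ℝ} {h : ℝ → ℝ} {lam mu : ℕ → ℝ} {u : ℕ → ℝ → ℝ}

theorem eventually_fastSlow (hp : 1 < p) (hh : StandingCond h) (hg : GrowthCond p h)
    (hsol : ∀ n, IsRadialSolution p h (lam n) (mu n) (u n)) (hmu : Tendsto mu atTop atTop)
    {ρ : ℝ} (hρ : 0 < ρ) :
    ∀ᶠ n in atTop, FastSlow p (mu n ^ p) ρ (fun x => u n (Real.exp x) / mu n)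
      (fun x => -(p * mu n ^ (p - 1) * (Real.exp x * deriv (u n) (Real.exp x))))
      (fun x => bubblePhi p h (lam n) (u n) (Real.exp x)) := by
  obtain ⟨t₀, -, hpos⟩ := hh.eventually_pos
  obtain ⟨T, hT⟩ := eventually_atTop.1 ((eventually_ge_atTop t₀).and
    ((tendsto_growthError hp hg).abs.eventually_le_const (by simpa using hρ)))
  filter_upwards [hmu.eventually_gt_atTop 0, hmu.eventually_ge_atTop (T / ρ)] with n h0 h1
  refine (hsol n).fastSlow hp hh h0 (T := T) ?_ fun t ht => ⟨hpos t (hT t ht).1, (hT t ht).2⟩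
  rw [div_le_iff₀ hρ] at h1
  linarith

/-- Centres of the `k`-th bubble exist; moreover they can be chosen at the points where
`p u ^ (p - 1) (- r u') = 2` up to a vanishing error. -/
theorem exists_isBubbleCentre (hp : 2 < p) (hh : StandingCond h) (hg : GrowthCond p h)
    (hsol : ∀ n, IsRadialSolution p h (lam n) (mu n) (u n)) (hmu : Tendsto mu atTop atTop)
    (k : ℕ) : ∃ r : ℕ → ℝ, IsBubbleCentre p h lam mu u k r ∧
      Tendsto (fun n => -(p * mu n ^ (p - 1) * (r n * deriv (u n) (r n)))) atTop
        (𝓝 (2 / bubbleDelta p k ^ (p - 1))) := by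
  have hmp : Tendsto (fun n => mu n ^ p) atTop atTop :=
    (tendsto_rpow_atTop (by linarith)).comp hmu
  have hc := hasCentres_bubble hp hmp
    (fun ρ hρ => eventually_fastSlow (by linarith) hh hg hsol hmu hρ) k
  have hδ := (bubblePair_bounds hp k).1
  have hD := Real.rpow_pos_of_pos hδ (p - 1)
  set δ := bubbleDelta p k
  set a := bubbleA p k
  set F : ℕ → ℝ → ℝ := fun n r => |u n r / mu n - δ|
  set G : ℕ → ℝ → ℝ := fun n r => |δ ^ (p - 1) * -(p * mu n ^ (p - 1) * (r * deriv (u n) r)) - 2|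
  set H : ℕ → ℝ → ℝ := fun n r => |bubblePhi p h (lam n) (u n) r - a ^ 2 / 2|
  obtain ⟨r, hr, hlim⟩ := exists_seq_tendsto_zero (d := fun n r => F n r + G n r + H n r)
    (s := Ioo (0 : ℝ) 1) ⟨1 / 2, by norm_num, by norm_num⟩ (fun n x => by positivity)
    (fun ε hε => (hc (ε / 3) (by linarith)).mono fun n ⟨x, hx, h1, h2, h3⟩ =>
      ⟨Real.exp x, IsRadialSolution.exp_mem hx, by simp only [F, G, H]; linarith⟩)
  have hF0 : ∀ n x, 0 ≤ F n x := fun n x => abs_nonneg _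
  have hG0 : ∀ n x, 0 ≤ G n x := fun n x => abs_nonneg _
  have hH0 : ∀ n x, 0 ≤ H n x := fun n x => abs_nonneg _
  have hF : Tendsto (fun n => F n (r n)) atTop (𝓝 0) := squeeze_zero (fun n => hF0 n _)
    (fun n => by linarith [hG0 n (r n), hH0 n (r n)]) hlim
  have hG : Tendsto (fun n => G n (r n)) atTop (𝓝 0) := squeeze_zero (fun n => hG0 n _)
    (fun n => by linarith [hF0 n (r n), hH0 n (r n)]) hlim
  have hH : Tendsto (fun n => H n (r n)) atTop (𝓝 0) := squeeze_zero (fun n => hH0 n _)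
    (fun n => by linarith [hF0 n (r n), hG0 n (r n)]) hlim
  refine ⟨r, ⟨hr, ?_, ?_⟩, ?_⟩
  · exact tendsto_iff_norm_sub_tendsto_zero.2 hF
  · exact tendsto_iff_norm_sub_tendsto_zero.2 hH
  · have h1 := (tendsto_iff_norm_sub_tendsto_zero.2 hG).div_const (δ ^ (p - 1))
    refine h1.congr fun n => ?_
    rw [mul_div_cancel_left₀ _ hD.ne']

/-- Points of height at most `c < δ` lie beyond the points whose height tends to `δ`. -/
theorem eventually_lt_of_ratio_lt (hh : StandingCond h)
    (hsol : ∀ n, IsRadialSolution p h (lam n) (mu n) (u n)) (hmu : Tendsto mu atTop atTop)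
    {r : ℕ → ℝ} (hr : ∀ n, r n ∈ Ioo (0 : ℝ) 1) {δ c : ℝ}
    (hu : Tendsto (fun n => u n (r n) / mu n) atTop (𝓝 δ)) (hc : c < δ) :
    ∀ᶠ n in atTop, ∀ s ∈ Ioo (0 : ℝ) 1, u n s / mu n ≤ c → r n < s := by
  filter_upwards [hu.eventually_const_lt hc, hmu.eventually_gt_atTop 0] with n h1 h2 s hs hsc
  by_contra hle
  have h3 := (hsol n).antitoneOn hh (Ioo_subset_Icc_self hs) (Ioo_subset_Icc_self (hr n))
    (not_lt.1 hle)
  have h4 : u n (r n) / mu n ≤ u n s / mu n := by gcongr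
  linarith

/-- For each `k`, the centres of the `k`-th bubble bound `|log λ| / μ ^ p` by `(p + 1) δ_k ^ p`
in the limit. -/
theorem tendsto_log_one_div_lam (hp : 2 < p) (hh : StandingCond h) (hg : GrowthCond p h)
    (hsol : ∀ n, IsRadialSolution p h (lam n) (mu n) (u n)) (hmu : Tendsto mu atTop atTop) :
    Tendsto (fun n => Real.log (1 / lam n) / mu n ^ p) atTop (𝓝 0) := by
  rw [Metric.tendsto_nhds]
  intro ε hε
  have hδp : Tendsto (fun k => (p + 1) * bubbleDelta p k ^ p) atTop (𝓝 ((p + 1) * 0 ^ p)) :=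
    ((tendsto_bubbleDelta hp).rpow_const (Or.inr (by linarith))).const_mul _
  rw [Real.zero_rpow (by linarith), mul_zero] at hδp
  obtain ⟨k, hk⟩ := (hδp.eventually_lt_const hε).exists
  obtain ⟨r, hr, hZ⟩ := exists_isBubbleCentre hp hh hg hsol hmu k
  obtain ⟨hδ, ha0, -⟩ := bubblePair_bounds hp k
  have hD := Real.rpow_pos_of_pos hδ (p - 1)
  have hδp0 := Real.rpow_pos_of_pos hδ p
  have h1 := tendsto_log_lam_add (by linarith) hh hg (fun n => (hsol n).lam_pos) hmu
    (fun n => (hr.mem n).1) hδ (by positivity) hr.height hr.phi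
  -- concavity bounds `log (1 / r)` by `p μ ^ p V / Z`
  have h2 := ((hr.height.div hZ (by positivity)).const_mul (2 * p)).add h1
  have e : 2 * p * (bubbleDelta p k / (2 / bubbleDelta p k ^ (p - 1))) + -bubbleDelta p k ^ p
      = (p - 1) * bubbleDelta p k ^ p := by
    rw [Real.rpow_sub_one hδ.ne']
    field_simp
    ring
  rw [e] at h2
  filter_upwards [h1.eventually_const_lt (show -ε < -bubbleDelta p k ^ p by nlinarith),
    h2.eventually_lt_const (show (p - 1) * bubbleDelta p k ^ p < ε by nlinarith),
    hmu.eventually_gt_atTop 0, hZ.eventually_const_lt (show 0 < 2 / bubbleDelta p k ^ (p - 1) by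
      positivity)] with n g1 g2 hm hz
  have hmp := Real.rpow_pos_of_pos hm p
  have hlog := (hsol n).neg_mul_deriv_mul_log_le hh (hr.mem n)
  have hrl : Real.log (r n) < 0 := Real.log_neg (hr.mem n).1 (hr.mem n).2
  rw [one_div, Real.log_inv] at hlog
  have hlog2 : -Real.log (r n) / mu n ^ p ≤ p * (u n (r n) / mu n /
      -(p * mu n ^ (p - 1) * (r n * deriv (u n) (r n)))) := by
    rw [← mul_div_assoc, div_le_div_iff₀ hmp hz, Real.rpow_sub_one hm.ne']
    have e2 : p * (u n (r n) / mu n) * mu n ^ p = p * (mu n ^ p / mu n) * u n (r n) := by ring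
    have := mul_le_mul_of_nonneg_left hlog (show 0 ≤ p * (mu n ^ p / mu n) by positivity)
    rw [e2]
    linarith
  have e3 : (Real.log (lam n) + 2 * Real.log (r n)) / mu n ^ p
      = Real.log (lam n) / mu n ^ p - 2 * (-Real.log (r n) / mu n ^ p) := by ring
  rw [e3] at g1 g2
  simp only [Pi.div_apply] at g2
  have hpos : 0 ≤ -Real.log (r n) / mu n ^ p := div_nonneg (by linarith) hmp.le
  rw [Real.dist_eq, sub_zero, one_div, Real.log_inv, neg_div, abs_neg, abs_lt]
  constructor <;> linarith

/-- A chain of `J` centres with rapidly decreasing heights, each step of which adds at least one to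
the integral. -/
theorem exists_centre_le_integral (hp : 2 < p) (hh : StandingCond h) (hg : GrowthCond p h)
    (hsol : ∀ n, IsRadialSolution p h (lam n) (mu n) (u n)) (hmu : Tendsto mu atTop atTop)
    (J : ℕ) : ∃ k : ℕ, ∃ r : ℕ → ℝ, IsBubbleCentre p h lam mu u k r ∧
      Tendsto (fun n => -(p * mu n ^ (p - 1) * (r n * deriv (u n) (r n)))) atTop
        (𝓝 (2 / bubbleDelta p k ^ (p - 1))) ∧
      ∀ᶠ n in atTop, (J : ℝ) ≤ p * ∫ s in (0 : ℝ)..(r n),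
        lam n * u n s ^ (p - 1) * nonlin p h (u n s) * s := by
  have hp1 : 1 < p := by linarith
  induction J with
  | zero =>
    obtain ⟨r, hr, hZ⟩ := exists_isBubbleCentre hp hh hg hsol hmu 0
    refine ⟨0, r, hr, hZ, Eventually.of_forall fun n => ?_⟩
    have := ((hsol n).integral_weighted_source_mono hp1 hh le_rfl (hr.mem n).1.le (hr.mem n).2.le).2
    have := mul_nonneg (show 0 ≤ p by linarith) this
    simpa using this
  | succ J ih =>
    obtain ⟨k, r, hr, hZ, hJ⟩ := ih
    have hδ := (bubblePair_bounds hp k).1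
    have hD := Real.rpow_pos_of_pos hδ (p - 1)
    -- a later bubble whose height is so small that the integral between the centres exceeds `1`
    have hlim : Tendsto (fun j => bubbleDelta p j ^ (p - 1)) atTop (𝓝 (0 ^ (p - 1))) :=
      (tendsto_bubbleDelta hp).rpow_const (Or.inr (by linarith))
    rw [Real.zero_rpow (by linarith)] at hlim
    obtain ⟨j, hj, hjδ⟩ := ((hlim.eventually_lt_const (half_pos hD)).and
      ((tendsto_bubbleDelta hp).eventually_lt_const hδ)).exists
    obtain ⟨s, hs, hZs⟩ := exists_isBubbleCentre hp hh hg hsol hmu j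
    have hδj := (bubblePair_bounds hp j).1
    have hDj := Real.rpow_pos_of_pos hδj (p - 1)
    refine ⟨j, s, hs, hZs, ?_⟩
    obtain ⟨c, hc1, hc2⟩ := exists_between hjδ
    have hgain := (hs.height.rpow_const (p := p - 1) (Or.inl hδj.ne')).mul (hZs.sub hZ)
    have hval : 1 < bubbleDelta p j ^ (p - 1) *
        (2 / bubbleDelta p j ^ (p - 1) - 2 / bubbleDelta p k ^ (p - 1)) := by
      rw [mul_sub, mul_div_cancel₀ _ hDj.ne', ← mul_div_assoc]
      have : bubbleDelta p j ^ (p - 1) * 2 / bubbleDelta p k ^ (p - 1) < 1 := by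
        rw [div_lt_one hD]; linarith
      linarith
    filter_upwards [hJ, eventually_lt_of_ratio_lt hh hsol hmu hr.mem hr.height hc2,
      hs.height.eventually_lt_const hc1, hgain.eventually_const_lt hval,
      hmu.eventually_gt_atTop 0] with n g1 g2 g3 g4 hm
    have hrs := g2 (s n) (hs.mem n) g3.le
    have h1 := ((hsol n).integral_weighted_source_mono hp1 hh (hr.mem n).1.le hrs.le
      (hs.mem n).2.le).1
    have h2 := (hsol n).le_integral_weighted_source hp1 hh (hr.mem n).1 hrs.le (hs.mem n).2
    have hmp := Real.rpow_pos_of_pos hm (p - 1)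
    rw [Real.div_rpow ((hsol n).pos _ (hs.mem n)).le hm.le] at g4
    have e : u n (s n) ^ (p - 1) / mu n ^ (p - 1) *
        (-(p * mu n ^ (p - 1) * (s n * deriv (u n) (s n)))
          - -(p * mu n ^ (p - 1) * (r n * deriv (u n) (r n))))
        = p * (u n (s n) ^ (p - 1) * (r n * deriv (u n) (r n) - s n * deriv (u n) (s n))) := by
      field_simp
      ring
    rw [e] at g4
    have h3 := mul_le_mul_of_nonneg_left h2 (show 0 ≤ p by linarith)
    rw [← h1, mul_add]
    push_cast
    linarith

theorem tendsto_integral_weighted_source (hp : 2 < p) (hh : StandingCond h) (hg : GrowthCond p h)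
    (hsol : ∀ n, IsRadialSolution p h (lam n) (mu n) (u n)) (hmu : Tendsto mu atTop atTop)
    {r : ℕ → ℝ} (hr : ∀ n, r n ∈ Ioo (0 : ℝ) 1)
    (hu : Tendsto (fun n => u n (r n) / mu n) atTop (𝓝 0)) :
    Tendsto (fun n => p * ∫ s in (0 : ℝ)..(r n),
      lam n * u n s ^ (p - 1) * nonlin p h (u n s) * s) atTop atTop := by
  rw [tendsto_atTop]
  intro b
  obtain ⟨J, hJ⟩ := exists_nat_ge b
  obtain ⟨k, c, hc, -, hcJ⟩ := exists_centre_le_integral hp hh hg hsol hmu J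
  have hδ := (bubblePair_bounds hp k).1
  filter_upwards [hcJ, eventually_lt_of_ratio_lt hh hsol hmu hc.mem hc.height (half_lt_self hδ),
    hu.eventually_lt_const (half_pos hδ)] with n g1 g2 g3
  have hlt := g2 (r n) (hr n) g3.le
  obtain ⟨h1, h2⟩ := (hsol n).integral_weighted_source_mono (by linarith) hh (hc.mem n).1.le hlt.le
    (hr n).2.le
  have h3 := mul_nonneg (show 0 ≤ p by linarith) h2
  rw [← h1, mul_add]
  linarith

theorem tendsto_mul_apply (hp : 2 < p) (hh : StandingCond h) (hg : GrowthCond p h)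
    (hsol : ∀ n, IsRadialSolution p h (lam n) (mu n) (u n)) (hmu : Tendsto mu atTop atTop)
    {r : ℝ} (hr : r ∈ Ico (0 : ℝ) 1) :
    Tendsto (fun n => p * mu n ^ (p - 1) * u n r) atTop atTop := by
  have hp0 : 0 < p := by linarith
  have hmp : Tendsto (fun n => mu n ^ p) atTop atTop := (tendsto_rpow_atTop hp0).comp hmu
  have hmain : ∀ c > 0, Tendsto (fun n => p * c * mu n ^ p) atTop atTop := fun c hc =>
    hmp.const_mul_atTop (mul_pos hp0 hc)
  have hcomp : ∀ c n, 0 < mu n → c ≤ u n r / mu n →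
      p * c * mu n ^ p ≤ p * mu n ^ (p - 1) * u n r := by
    intro c n hm hc
    rw [le_div_iff₀ hm] at hc
    have e : mu n ^ p = mu n ^ (p - 1) * mu n := by
      rw [← Real.rpow_add_one hm.ne', sub_add_cancel]
    have := mul_le_mul_of_nonneg_left hc
      (mul_pos hp0 (Real.rpow_pos_of_pos hm (p - 1))).le
    rw [e]
    linarith
  rcases hr.1.eq_or_lt with h0 | h0
  · refine tendsto_atTop_mono' _ ?_ (hmain 1 one_pos)
    filter_upwards [hmu.eventually_gt_atTop 0] with n hm
    exact hcomp 1 n hm (by rw [← h0, (hsol n).apply_zero, div_self hm.ne'])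
  have hr1 : r ∈ Ioo (0 : ℝ) 1 := ⟨h0, hr.2⟩
  have hl : 0 < Real.log (1 / r) := Real.log_pos (by rw [lt_div_iff₀ h0]; linarith [hr.2])
  rw [tendsto_atTop]
  intro M
  have hlim : Tendsto (fun j => M * bubbleDelta p j ^ (p - 1)) atTop (𝓝 (M * 0 ^ (p - 1))) :=
    ((tendsto_bubbleDelta hp).rpow_const (Or.inr (by linarith))).const_mul M
  rw [Real.zero_rpow (by linarith), mul_zero] at hlim
  obtain ⟨k, hk⟩ := (hlim.eventually_lt_const hl).exists
  obtain ⟨c, hc, hZ⟩ := exists_isBubbleCentre hp hh hg hsol hmu k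
  have hδ := (bubblePair_bounds hp k).1
  have hD := Real.rpow_pos_of_pos hδ (p - 1)
  filter_upwards [eventually_lt_of_ratio_lt hh hsol hmu hc.mem hc.height (half_lt_self hδ),
    hZ.eventually_const_lt (show 1 / bubbleDelta p k ^ (p - 1) < 2 / bubbleDelta p k ^ (p - 1) by
      gcongr; norm_num),
    (hmain _ (half_pos hδ)).eventually_ge_atTop M, hmu.eventually_gt_atTop 0] with n g1 g2 g3 hm
  rcases le_total (u n r / mu n) (bubbleDelta p k / 2) with hle | hge
  · have hcr := g1 r hr1 hle
    have h1 := (hsol n).antitoneOn_mul_deriv hh (hc.mem n) hr1 hcr.le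
    have h2 := (hsol n).neg_mul_deriv_mul_log_le hh hr1
    have hmp := mul_pos hp0 (Real.rpow_pos_of_pos hm (p - 1))
    have h3 := mul_le_mul_of_nonneg_left h1 hmp.le
    have h4 := mul_le_mul_of_nonneg_left h2 hmp.le
    simp only at h3
    have h5 : 1 / bubbleDelta p k ^ (p - 1) * Real.log (1 / r)
        ≤ -(p * mu n ^ (p - 1) * (r * deriv (u n) r)) * Real.log (1 / r) :=
      mul_le_mul_of_nonneg_right (by linarith) hl.le
    have h6 : M ≤ 1 / bubbleDelta p k ^ (p - 1) * Real.log (1 / r) := by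
      rw [div_mul_eq_mul_div, le_div_iff₀ hD, one_mul]
      exact hk.le
    linarith
  · exact g3.trans (hcomp _ n hm hge)

end

theorem theorem1p5 (p : ℝ) (hp : 2 < p) (h : ℝ → ℝ) (hstand : StandingCond h)
    (hgrowth : GrowthCond p h) (lam mu : ℕ → ℝ) (u : ℕ → ℝ → ℝ)
    (hsol : ∀ n, IsRadialSolution p h (lam n) (mu n) (u n))
    (hmu : Tendsto mu atTop atTop) :
    (∀ r : ℕ → ℝ, (∀ n, r n ∈ Ioo (0 : ℝ) 1) →
      Tendsto (fun n => u n (r n) / mu n) atTop (𝓝 0) →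
        Tendsto (fun n => p * ∫ s in (0 : ℝ)..(r n),
          lam n * u n s ^ (p - 1) * nonlin p h (u n s) * s) atTop atTop ∧
        Tendsto (fun n => p * mu n ^ (p - 1) * ∫ s in (0 : ℝ)..(r n),
          lam n * nonlin p h (u n s) * s) atTop atTop) ∧
    Tendsto (fun n => Real.log (1 / lam n) / mu n ^ p) atTop (𝓝 0) ∧
    (∀ k : ℕ,
      (∃ r : ℕ → ℝ, IsBubbleCentre p h lam mu u k r) ∧
      ∀ r : ℕ → ℝ, IsBubbleCentre p h lam mu u k r →
        Tendsto (fun n => Real.log (1 / r n) / mu n ^ p) atTop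
          (𝓝 (bubbleDelta p k ^ p / 2))) ∧
    (∀ r ∈ Ico (0 : ℝ) 1,
      Tendsto (fun n => p * mu n ^ (p - 1) * u n r) atTop atTop) := by
  have hlam := tendsto_log_one_div_lam hp hstand hgrowth hsol hmu
  refine ⟨fun r hr hu => ?_, hlam, fun k => ⟨?_, fun r hr => ?_⟩,
    fun r hr => tendsto_mul_apply hp hstand hgrowth hsol hmu hr⟩
  · have h1 := tendsto_integral_weighted_source hp hstand hgrowth hsol hmu hr hu
    refine ⟨h1, tendsto_atTop_mono (fun n => ?_) h1⟩
    have := (hsol n).integral_weighted_source_le (by linarith) hstand (hr n).1.le (hr n).2.le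
    have := mul_le_mul_of_nonneg_left this (show 0 ≤ p by linarith)
    rwa [← mul_assoc] at this
  · obtain ⟨r, hr, -⟩ := exists_isBubbleCentre hp hstand hgrowth hsol hmu k
    exact ⟨r, hr⟩
  · obtain ⟨hδ, ha0, -⟩ := bubblePair_bounds hp k
    have h1 := tendsto_log_lam_add (by linarith) hstand hgrowth (fun n => (hsol n).lam_pos) hmu
      (fun n => (hr.mem n).1) hδ (by positivity) hr.height hr.phi
    have h2 := (h1.add hlam).neg.div_const 2
    rw [add_zero, neg_neg] at h2
    refine h2.congr fun n => ?_
    rw [one_div, one_div, Real.log_inv, Real.log_inv]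
    ring
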